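/- Let $q$ be a power of a prime $p$, let $r=2s+1$ be an odd prime coprime to $q$ such that $q$ is a primitive root modulo $r$, and let $\mathbb F_q(\theta)=\mathbb F_q[x]/\Phi_r(x)\cong\mathbb F_{q^{r-1}}$, where $\Phi_r$ is the $r$-th cyclotomic polynomial and $\theta$ is the class of $x$. Assume that $r-2<p$. Let $e$ be any integer, $f$ any integer coprime to $r$, and $a\in\mathbb F_q$ any non-zero element. Then: (a) The multiplicative order of $\theta^e(\theta^f+a)$ is larger than $$\frac{\exp\left(2.5\sqrt{r-2}\right)}{13(r-2)}.$$ (b) If $r>3$ and $a\neq 1,-1$, then the multiplicative order of $\theta^e(\theta^f+a)$ is larger than $$\frac{2\exp\left(2.5\sqrt2\,\sqrt{r-3}\right)}{169(r-3)^2}.$$ (c) Let $r>3$ and $a\neq 1,-1$, and let $\rho_2(n)$ denote the highest power of $2$ dividing the positive integer $n$. Then exactly one of $\rho_2(q^{(r-1)/2}-1)=2$ and $\rho_2(q^{(r-1)/2}+1)=2$ holds, and the element $$z=\begin{cases}(\theta+\theta^{-1})^2\,(a\theta+1)(\theta+a)^{-1} & \text{if } \rho_2(q^{(r-1)/2}-1)=2,\\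 (\theta+\theta^{-1})\,[(a\theta+1)(\theta+a)^{-1}]^2 & \text{if } \rho_2(q^{(r-1)/2}+1)=2\end{cases}$$ has multiplicative order larger than $$\frac{\exp\left(2.5\left(1+\frac{\sqrt2}{2}\right)\sqrt{r-3}\right)}{169(r-2)(r-3)}.$$ -/

import Mathlib

/-- The highest power of two that divides `n`, for `n ≠ 0`; thus `rhoTwo n = 2` says that
`n` is divisible by `2` but not by `4`. -/
def rhoTwo (n : ℕ) : ℕ := 2 ^ padicValNat 2 n

/-! Let ζ be a primitive r-th root of unity. Since q generates the units modulo r, powers of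
Frobenius send ζ to every ζ^m with r ∤ m, so each conjugate ζ^(me)(ζ^m + a) of g = ζ^e(ζ + a) is a
power of g. Multiplying the conjugates over the parts m of a partition of n gives ζ^(ne) ∏(ζ^m + a),
with a prefactor that depends only on n. If n < r - 1, equality of two such products lifts to an
equality of polynomials ∏(X^m + a). The binomials X^m + a are multiplicatively independent while m
is nonzero in F: a suitable root of the one of largest degree is a root of no smaller one. As r - 2
< p, distinct partitions of r - 2 give distinct powers of g, so g has order at least the number of
partitions of r - 2. A general f is covered by taking ζ = θ^f.

If a² ≠ 1, the conjugates at ζ^(-m) contribute the reciprocals aX^m + 1, independent of the former.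
Pairs of partitions of (r - 3)/2 then give part (b).

For (c) put Q = q^s with s = (r - 1)/2. The map x ↦ x^Q sends θ to θ⁻¹, so it fixes θ + θ⁻¹ and
inverts (aθ + 1)/(θ + a). Their orders divide Q - 1 and Q + 1, which share only the factor 2.
Squaring the right one makes the orders coprime, at the cost of a factor 2 in the product of the
orders.

The explicit constants come from Maróti's bound p(n) > exp(2.5√n)/(13n), proved by strong induction
from a divisor-sum recurrence. The slack is 2.5²/4 < π²/6, enough for n ≥ 256; smaller n are
certified by a table (`exp_div_lt_card_partition`). -/

/-! ### The recurrence for the partition function. -/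

open Finset in
/-- Counting the occurrences of the part `j` with multiplicity at least `k` in the partitions
of `n` bounds the sum of all parts of all partitions of `n` from below. -/
theorem sum_mul_card_partition_le (n K : ℕ) :
    ∑ k ∈ Icc 1 K, ∑ j ∈ Icc 1 n,
      (if j * k ≤ n then j * Fintype.card (Nat.Partition (n - j * k)) else 0) ≤
      n * Fintype.card (Nat.Partition n) := by
  classical
  have hcount : ∀ l : Nat.Partition n, ∑ j ∈ Icc 1 n, j * l.parts.count j = n := by
    intro l
    conv_rhs => rw [← l.parts_sum, Finset.sum_multiset_count]
    symm
    rw [Finset.sum_subset (s₂ := Icc 1 n)]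
    · exact Finset.sum_congr rfl fun j _ => by rw [smul_eq_mul, mul_comm]
    · intro j hj
      rw [Multiset.mem_toFinset] at hj
      rw [mem_Icc]
      refine ⟨l.parts_pos hj, ?_⟩
      calc j ≤ l.parts.sum := Multiset.single_le_sum (fun _ _ => Nat.zero_le _) _ hj
        _ = n := l.parts_sum
    · intro j _ hj
      rw [Multiset.mem_toFinset] at hj
      simp [Multiset.count_eq_zero.2 hj]
  -- Adjoining k copies of j embeds the partitions of n - jk into those of n in which j occurs at
  -- least k times.
  have hinj : ∀ j ∈ Icc 1 n, ∀ k : ℕ, j * k ≤ n →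
      Fintype.card (Nat.Partition (n - j * k)) ≤
        #{l : Nat.Partition n | k ≤ l.parts.count j} := by
    intro j hj k hjk
    rw [mem_Icc] at hj
    rw [← Finset.card_univ]
    refine Finset.card_le_card_of_injOn
      (fun m => ⟨m.parts + Multiset.replicate k j, ?_, ?_⟩) ?_ ?_
    · intro i hi
      rcases Multiset.mem_add.1 hi with hi | hi
      · exact m.parts_pos hi
      · rw [Multiset.eq_of_mem_replicate hi]; exact hj.1
    · rw [Multiset.sum_add, m.parts_sum, Multiset.sum_replicate, smul_eq_mul, mul_comm k]
      omega
    · intro m _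
      simp
    · intro m _ m' _ h
      have := congrArg Nat.Partition.parts h
      exact Nat.Partition.ext (by simpa using this)
  calc _ ≤ ∑ k ∈ Icc 1 K, ∑ j ∈ Icc 1 n,
        ∑ l : Nat.Partition n, j * (if k ≤ l.parts.count j then 1 else 0) := by
        refine Finset.sum_le_sum fun k _ => Finset.sum_le_sum fun j hj => ?_
        split_ifs with hjk
        · rw [← Finset.mul_sum, ← Finset.card_filter]
          exact Nat.mul_le_mul_left _ (hinj j hj k hjk)
        · exact Nat.zero_le _
    _ = ∑ l : Nat.Partition n, ∑ j ∈ Icc 1 n,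
          j * ∑ k ∈ Icc 1 K, (if k ≤ l.parts.count j then 1 else 0) := by
        rw [Finset.sum_comm]
        conv_lhs => enter [2, j]; rw [Finset.sum_comm]
        rw [Finset.sum_comm]
        simp_rw [Finset.mul_sum]
    _ ≤ ∑ l : Nat.Partition n, ∑ j ∈ Icc 1 n, j * l.parts.count j := by
        refine Finset.sum_le_sum fun l _ => Finset.sum_le_sum fun j _ =>
          Nat.mul_le_mul_left _ ?_
        rw [← Finset.card_filter]
        calc _ ≤ #(Icc 1 (l.parts.count j)) := Finset.card_le_card fun k hk => by
              simp only [Finset.mem_filter, mem_Icc] at hk ⊢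
              exact ⟨hk.1.1, hk.2⟩
          _ = _ := by simp
    _ = n * Fintype.card (Nat.Partition n) := by
        simp [hcount, mul_comm]

open Finset in
/-- The divisor-sum form of the recurrence for the number of partitions. -/
theorem sum_divisors_mul_card_partition_le (n : ℕ) :
    ∑ m ∈ Icc 1 n, (∑ d ∈ m.divisors, d) * Fintype.card (Nat.Partition (n - m)) ≤
      n * Fintype.card (Nat.Partition n) := by
  refine le_trans (le_of_eq ?_) (sum_mul_card_partition_le n n)
  -- Group the double sum by m = jk. Both factors are at most n, so cutting k off at n loses no
  -- term.
  have hm : ∀ m ∈ Icc 1 n, (∑ d ∈ m.divisors, d) * Fintype.card (Nat.Partition (n - m)) =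
      ∑ k ∈ Icc 1 n, ∑ j ∈ Icc 1 n,
        if j * k = m then j * Fintype.card (Nat.Partition (n - m)) else 0 := by
    intro m hm
    rw [mem_Icc] at hm
    rw [Finset.sum_mul, ← Finset.sum_product', ← Finset.sum_filter,
      ← Nat.sum_divisorsAntidiagonal (fun d _ => d * Fintype.card (Nat.Partition (n - m)))]
    refine Finset.sum_bij' (fun x _ => (x.2, x.1)) (fun x _ => (x.2, x.1)) ?_ ?_ ?_ ?_ ?_
    · intro x hx
      rw [Nat.mem_divisorsAntidiagonal] at hx
      have h1 : 0 < x.1 := Nat.pos_of_ne_zero fun h => by simp [h] at hx; omega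
      have h2 : 0 < x.2 := Nat.pos_of_ne_zero fun h => by simp [h] at hx; omega
      have h3 := Nat.le_mul_of_pos_right x.1 h2
      have h4 := Nat.le_mul_of_pos_left x.2 h1
      simp only [Finset.mem_filter, Finset.mem_product, mem_Icc]
      refine ⟨⟨⟨?_, ?_⟩, ?_, ?_⟩, hx.1⟩ <;> omega
    · intro x hx
      simp only [Finset.mem_filter, Finset.mem_product, mem_Icc] at hx
      rw [Nat.mem_divisorsAntidiagonal]
      exact ⟨hx.2, by omega⟩
    all_goals intros; rfl
  rw [Finset.sum_congr rfl hm, Finset.sum_comm]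
  refine Finset.sum_congr rfl fun k hk => ?_
  rw [Finset.sum_comm]
  refine Finset.sum_congr rfl fun j hj => ?_
  rw [mem_Icc] at hk hj
  have := Nat.mul_pos hj.1 hk.1
  rw [Finset.sum_ite_eq (Icc 1 n) (j * k) (fun m => j * Fintype.card (Nat.Partition (n - m)))]
  simp [mem_Icc, Nat.one_le_iff_ne_zero.2 this.ne']

/-! ### Moments of the geometric series and the tail of ζ(2). -/

section PartitionBound

open Real

theorem HasSum.of_eq {f g : ℕ → ℝ} {a b : ℝ} (h : HasSum f a) (hf : ∀ n, f n = g n)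
    (ha : a = b) : HasSum g b := by
  rw [← funext hf, ← ha]
  exact h

theorem hasSum_mul_exp_neg {u : ℝ} (hu : 0 < u) :
    HasSum (fun j : ℕ => (j : ℝ) * exp (-u) ^ j) (exp (-u) / (1 - exp (-u)) ^ 2) := by
  apply hasSum_coe_mul_geometric_of_norm_lt_one
  rw [Real.norm_of_nonneg (exp_pos _).le]
  exact exp_lt_one_iff.2 (by linarith)

theorem cast_add_choose_three (n : ℕ) :
    ((n + 3).choose 3 : ℝ) = (n + 1) * (n + 2) * (n + 3) / 6 := by
  have h := Nat.ascFactorial_eq_factorial_mul_choose n 3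
  simp only [Nat.ascFactorial, Nat.factorial] at h
  have h' := congrArg (Nat.cast : ℕ → ℝ) h
  push_cast at h'
  linarith

theorem cast_add_choose_five (n : ℕ) :
    ((n + 5).choose 5 : ℝ) = (n + 1) * (n + 2) * (n + 3) * (n + 4) * (n + 5) / 120 := by
  have h := Nat.ascFactorial_eq_factorial_mul_choose n 5
  simp only [Nat.ascFactorial, Nat.factorial] at h
  have h' := congrArg (Nat.cast : ℕ → ℝ) h
  push_cast at h'
  linarith

/-- Since j³ = (j - 1)j(j + 1) + j and the product sums to a multiple of a power of q/(1 - q)², the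
moment is a polynomial in that one quantity. The fifth moment works the same way with (j - 2)⋯(j +
2). -/
theorem hasSum_cube_mul_exp_neg {u : ℝ} (hu : 0 < u) :
    HasSum (fun j : ℕ => (j : ℝ) ^ 3 * exp (-u) ^ j)
      (6 * (exp (-u) / (1 - exp (-u)) ^ 2) ^ 2 + exp (-u) / (1 - exp (-u)) ^ 2) := by
  have hq : ‖exp (-u)‖ < 1 := by
    rw [Real.norm_of_nonneg (exp_pos _).le]
    exact exp_lt_one_iff.2 (by linarith)
  set q := exp (-u)
  have h : HasSum (fun j : ℕ => ((j : ℝ) - 1) * j * (j + 1) * q ^ j)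
      (6 * (q / (1 - q) ^ 2) ^ 2) := by
    rw [← hasSum_nat_add_iff' 2]
    refine ((hasSum_choose_mul_geometric_of_norm_lt_one 3 hq).mul_left (6 * q ^ 2)).of_eq
      (fun n => ?_) ?_
    · rw [cast_add_choose_three]
      push_cast
      ring
    · rw [div_pow, ← pow_mul]
      simp [Finset.sum_range_succ]
      ring
  exact (h.add (hasSum_mul_exp_neg hu)).of_eq (fun j => by ring) rfl

theorem hasSum_pow_five_mul_exp_neg {u : ℝ} (hu : 0 < u) :
    HasSum (fun j : ℕ => (j : ℝ) ^ 5 * exp (-u) ^ j)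
      (120 * (exp (-u) / (1 - exp (-u)) ^ 2) ^ 3 + 30 * (exp (-u) / (1 - exp (-u)) ^ 2) ^ 2 +
        exp (-u) / (1 - exp (-u)) ^ 2) := by
  have hq : ‖exp (-u)‖ < 1 := by
    rw [Real.norm_of_nonneg (exp_pos _).le]
    exact exp_lt_one_iff.2 (by linarith)
  have h3 := hasSum_cube_mul_exp_neg hu
  have h1 := hasSum_mul_exp_neg hu
  set q := exp (-u)
  have h : HasSum (fun j : ℕ => ((j : ℝ) - 2) * (j - 1) * j * (j + 1) * (j + 2) * q ^ j)
      (120 * (q / (1 - q) ^ 2) ^ 3) := by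
    rw [← hasSum_nat_add_iff' 3]
    refine ((hasSum_choose_mul_geometric_of_norm_lt_one 5 hq).mul_left (120 * q ^ 3)).of_eq
      (fun n => ?_) ?_
    · rw [cast_add_choose_five]
      push_cast
      ring
    · rw [div_pow, ← pow_mul]
      simp [Finset.sum_range_succ]
      ring
  exact ((h.add (h3.mul_left 5)).sub (h1.mul_left 4)).of_eq (fun j => by ring) (by ring)

theorem exp_neg_div_one_sub_sq {u : ℝ} (hu : 0 < u) :
    exp (-u) / (1 - exp (-u)) ^ 2 = 1 / (2 * cosh u - 2) := by
  have h1 : 1 < exp u := one_lt_exp_iff.2 hu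
  have h2 : exp u * exp u - 2 * exp u + 1 ≠ 0 := by nlinarith
  rw [cosh_eq, exp_neg]
  have h0 : exp u ≠ 0 := (exp_pos u).ne'
  have h3 : exp u - 1 ≠ 0 := by linarith
  have h4 : (exp u + (exp u)⁻¹) - 2 = (exp u - 1) ^ 2 / exp u := by field_simp; ring
  have h5 : 1 - (exp u)⁻¹ = (exp u - 1) / exp u := by field_simp
  have h6 : 2 * ((exp u + (exp u)⁻¹) / 2) - 2 = (exp u - 1) ^ 2 / exp u := by
    rw [← h4]; ring
  rw [h6, h5]
  field_simp

theorem le_two_cosh_sub_two (u : ℝ) :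
    u ^ 2 * (1 + u ^ 2 / 12 + (u ^ 2) ^ 2 / 360 + (u ^ 2) ^ 3 / 20160) ≤ 2 * cosh u - 2 := by
  have h := sum_le_hasSum (Finset.range 5) (fun i _ => by rw [pow_mul]; positivity)
    (Real.hasSum_cosh u)
  simp [Finset.sum_range_succ, Nat.factorial] at h
  nlinarith

theorem two_mul_twelve_pow_le_factorial (n : ℕ) : 2 * 12 ^ n ≤ (2 * (n + 1)).factorial := by
  induction n with
  | zero => simp
  | succ n ih =>
    have : (2 * (n + 1 + 1)).factorial = (2 * n + 4) * ((2 * n + 3) * (2 * (n + 1)).factorial) := by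
      rw [show 2 * (n + 1 + 1) = 2 * (n + 1) + 1 + 1 by ring, Nat.factorial_succ,
        Nat.factorial_succ]
      ring
    rw [this, pow_succ]
    calc 2 * (12 ^ n * 12) = 4 * (3 * (2 * 12 ^ n)) := by ring
      _ ≤ (2 * n + 4) * ((2 * n + 3) * (2 * (n + 1)).factorial) := by
        gcongr <;> omega

/-- Compare the cosh series termwise with the geometric series of ratio u²/12; the first two terms
agree. -/
theorem two_cosh_sub_two_le {u : ℝ} (hu : u ^ 2 < 12) :
    2 * cosh u - 2 ≤ u ^ 2 * (1 - u ^ 2 / 12)⁻¹ := by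
  have hg := (hasSum_geometric_of_lt_one (r := u ^ 2 / 12) (by positivity)
    (by linarith)).mul_left (u ^ 2)
  have hc := ((hasSum_nat_add_iff' 1).2 (Real.hasSum_cosh u)).mul_left 2
  have := hasSum_le (fun n => ?_) hc hg
  · simp at this
    linarith
  · have h2 : (2 * 12 ^ n : ℝ) ≤ ((2 * (n + 1)).factorial : ℝ) := by
      exact_mod_cast two_mul_twelve_pow_le_factorial n
    rw [div_pow, ← mul_div_assoc, ← mul_div_assoc, div_le_div_iff₀ (by positivity) (by positivity),
      pow_mul, pow_succ]
    have := mul_le_mul_of_nonneg_left h2 (show 0 ≤ u ^ 2 * (u ^ 2) ^ n by positivity)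
    linarith

theorem le_exp_neg_div_one_sub_sq {u : ℝ} (hu : 0 < u) :
    1 / u ^ 2 - 1 / 12 ≤ exp (-u) / (1 - exp (-u)) ^ 2 := by
  have hpos : 0 < u ^ 2 := by positivity
  have hD : 0 < 2 * cosh u - 2 := lt_of_lt_of_le (by positivity) (le_two_cosh_sub_two u)
  rw [exp_neg_div_one_sub_sq hu]
  rcases lt_or_ge (u ^ 2) 12 with h | h
  · have hb : 0 < 1 - u ^ 2 / 12 := by linarith
    calc 1 / u ^ 2 - 1 / 12 = 1 / (u ^ 2 * (1 - u ^ 2 / 12)⁻¹) := by field_simp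
      _ ≤ _ := one_div_le_one_div_of_le hD (two_cosh_sub_two_le h)
  · have : 1 / u ^ 2 ≤ 1 / 12 := one_div_le_one_div_of_le (by norm_num) h
    have : 0 < 1 / (2 * cosh u - 2) := by positivity
    linarith

/-- The moment is asymptotic to 6/u⁴ but slightly exceeds it for small u; the excess in 6.12 turns
the claim into a polynomial inequality in u². -/
theorem cube_moment_le {u : ℝ} (hu : 0 < u) :
    6 * (exp (-u) / (1 - exp (-u)) ^ 2) ^ 2 + exp (-u) / (1 - exp (-u)) ^ 2 ≤ 6.12 / u ^ 4 := by
  rw [exp_neg_div_one_sub_sq hu]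
  have hD := le_two_cosh_sub_two u
  set w := u ^ 2 with hw
  have hw0 : 0 < w := by positivity
  set E := 1 + w / 12 + w ^ 2 / 360 with hE
  have hE0 : 0 < E := by positivity
  have hle : 1 / (2 * cosh u - 2) ≤ 1 / (w * E) :=
    one_div_le_one_div_of_le (by positivity)
      (le_trans (mul_le_mul_of_nonneg_left (by rw [hE]; linarith [pow_pos hw0 3]) hw0.le) hD)
  have h0 : 0 ≤ 1 / (2 * cosh u - 2) :=
    one_div_nonneg.2 (le_trans (by positivity) hD)
  have h4 : u ^ 4 = w ^ 2 := by rw [hw]; ring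
  calc _ ≤ 6 * (1 / (w * E)) ^ 2 + 1 / (w * E) := by gcongr
    _ = (6 + w * E) / (w ^ 2 * E ^ 2) := by field_simp
    _ ≤ 6.12 / u ^ 4 := by
      rw [h4, div_le_div_iff₀ (by positivity) (by positivity)]
      have : 6 + w * E ≤ 6.12 * E ^ 2 := by
        rw [hE]
        nlinarith [sq_nonneg (w ^ 2 - 60), sq_nonneg (w * (w - 7)), sq_nonneg (w - 7),
          pow_pos hw0 3]
      nlinarith [sq_nonneg w, mul_le_mul_of_nonneg_right this (sq_nonneg w)]

/-- The leading term is 120/u⁶. The generous 180 makes every coefficient of the resulting polynomial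
in u² nonnegative, and its weight in the recurrence is small. -/
theorem fifth_moment_le {u : ℝ} (hu : 0 < u) :
    120 * (exp (-u) / (1 - exp (-u)) ^ 2) ^ 3 + 30 * (exp (-u) / (1 - exp (-u)) ^ 2) ^ 2 +
        exp (-u) / (1 - exp (-u)) ^ 2 ≤ 180 / u ^ 6 := by
  rw [exp_neg_div_one_sub_sq hu]
  have hD := le_two_cosh_sub_two u
  set w := u ^ 2 with hw
  have hw0 : 0 < w := by positivity
  set E := 1 + w / 12 + w ^ 2 / 360 + w ^ 3 / 20160 with hE
  have hE0 : 0 < E := by positivity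
  have hle : 1 / (2 * cosh u - 2) ≤ 1 / (w * E) :=
    one_div_le_one_div_of_le (by positivity) hD
  have h0 : 0 ≤ 1 / (2 * cosh u - 2) :=
    one_div_nonneg.2 (le_trans (by positivity) hD)
  have h4 : u ^ 6 = w ^ 3 := by rw [hw]; ring
  calc _ ≤ 120 * (1 / (w * E)) ^ 3 + 30 * (1 / (w * E)) ^ 2 + 1 / (w * E) := by gcongr
    _ = (120 + 30 * (w * E) + (w * E) ^ 2) / (w ^ 3 * E ^ 3) := by field_simp
    _ ≤ 180 / u ^ 6 := by
      rw [h4, div_le_div_iff₀ (by positivity) (by positivity)]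
      have : 0 ≤ 180 * E ^ 3 - (120 + 30 * (w * E) + (w * E) ^ 2) := by
        rw [hE]
        ring_nf
        positivity
      nlinarith [mul_nonneg this (pow_pos hw0 3).le]

theorem pi_sq_div_six_sub_le (K : ℕ) (hK : 0 < K) :
    π ^ 2 / 6 - 1 / (K : ℝ) ≤ ∑ k ∈ Finset.Icc 1 K, 1 / (k : ℝ) ^ 2 := by
  have h := hasSum_zeta_two
  -- Telescoping: 1/(n + 1)² ≤ 1/n - 1/(n + 1), so the tail beyond K is at most 1/K.
  have hle : ∀ n ≥ K, ∑ k ∈ Finset.Icc 1 n, 1 / (k : ℝ) ^ 2 + 1 / (n : ℝ) ≤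
      ∑ k ∈ Finset.Icc 1 K, 1 / (k : ℝ) ^ 2 + 1 / (K : ℝ) := by
    intro n hn
    induction n, hn using Nat.le_induction with
    | base => rfl
    | succ n hn ih =>
      refine le_trans ?_ ih
      rw [Finset.sum_Icc_succ_top (by omega)]
      have hn0 : (0 : ℝ) < n := by exact_mod_cast (by omega : 0 < n)
      have : 1 / ((n + 1 : ℕ) : ℝ) ^ 2 + 1 / ((n + 1 : ℕ) : ℝ) ≤ 1 / n := by
        push_cast
        rw [div_add_div _ _ (by positivity) (by positivity),
          div_le_div_iff₀ (by positivity) (by positivity)]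
        nlinarith
      linarith
  have ht := h.tendsto_sum_nat
  rw [← Filter.tendsto_add_atTop_iff_nat 1] at ht
  have := le_of_tendsto ht (b := ∑ k ∈ Finset.Icc 1 K, 1 / (k : ℝ) ^ 2 + 1 / (K : ℝ))
    (Filter.eventually_atTop.2 ⟨K, fun n hn => ?_⟩)
  · linarith
  · refine le_trans ?_ (hle n hn)
    rw [Finset.sum_range_succ', Finset.range_eq_Ico,
      Finset.sum_Ico_add' (fun k : ℕ => 1 / (k : ℝ) ^ 2) 0 n 1]
    have : (0 : ℝ) ≤ 1 / n := by positivity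
    simp only [zero_add, CharP.cast_eq_zero, ne_eq, OfNat.ofNat_ne_zero, not_false_eq_true,
      zero_pow, div_zero, add_zero]
    have h2 : Finset.Ico 1 (n + 1) = Finset.Icc 1 n := by
      ext; simp [Finset.mem_Ico]
    rw [h2]
    linarith

/-! ### Maróti's bound for n ≤ 255, by a checked table. -/

/-- The sums of divisors of `1, …, 255`. -/
def divisorSumTable : List ℕ :=
  [1, 3, 4, 7, 6, 12, 8, 15, 13, 18, 12, 28, 14, 24, 24, 31, 18, 39, 20, 42, 32, 36, 24, 60, 31,
  42, 40, 56, 30, 72, 32, 63, 48, 54, 48, 91, 38, 60, 56, 90, 42, 96, 44, 84, 78, 72, 48, 124, 57,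
  93, 72, 98, 54, 120, 72, 120, 80, 90, 60, 168, 62, 96, 104, 127, 84, 144, 68, 126, 96, 144, 72,
  195, 74, 114, 124, 140, 96, 168, 80, 186, 121, 126, 84, 224, 108, 132, 120, 180, 90, 234, 112,
  168, 128, 144, 120, 252, 98, 171, 156, 217, 102, 216, 104, 210, 192, 162, 108, 280, 110, 216,
  152, 248, 114, 240, 144, 210, 182, 180, 144, 360, 133, 186, 168, 224, 156, 312, 128, 255, 176,
  252, 132, 336, 160, 204, 240, 270, 138, 288, 140, 336, 192, 216, 168, 403, 180, 222, 228, 266,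
  150, 372, 152, 300, 234, 288, 192, 392, 158, 240, 216, 378, 192, 363, 164, 294, 288, 252, 168,
  480, 183, 324, 260, 308, 174, 360, 248, 372, 240, 270, 180, 546, 182, 336, 248, 360, 228, 384,
  216, 336, 320, 360, 192, 508, 194, 294, 336, 399, 198, 468, 200, 465, 272, 306, 240, 504, 252,
  312, 312, 434, 240, 576, 212, 378, 288, 324, 264, 600, 256, 330, 296, 504, 252, 456, 224, 504,
  403, 342, 228, 560, 230, 432, 384, 450, 234, 546, 288, 420, 320, 432, 240, 744, 242, 399, 364,
  434, 342, 504, 280, 480, 336, 468, 252, 728, 288, 384, 432]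

/-- The pairs `(p(n), ⌈40 √n⌉)` for `n = 255, …, 0`, where `p` is the partition function. -/
def partitionTable : List (ℕ × ℕ) :=
  [(338854264248680, 639), (313891991306665, 638), (290726957916112, 637), (269232701252579, 635),
  (249291451168559, 634), (230793554364681, 633), (213636919820625, 632), (197726516681672, 630),
  (182973889854026, 629), (169296722391554, 628), (156618412527946, 627), (144867692496445, 625),
  (133978259344888, 624), (123888443077259, 623), (114540884553038, 621), (105882246722733, 620),
  (97862933703585, 619), (90436839668817, 618), (83561103925871, 616), (77195892663512, 615),
  (71304185514919, 614), (65851585970275, 612), (60806135438329, 611), (56138148670947, 610),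
  (51820051838712, 608), (47826239745920, 607), (44132934884255, 606), (40718063627362, 604),
  (37561133582570, 603), (34643126322519, 602), (31946390696157, 600), (29454549941750, 599),
  (27152408925615, 598), (25025873760111, 596), (23061871173849, 595), (21248279009367, 594),
  (19573856161145, 592), (18028182516671, 591), (16601598107914, 590), (15285151248481, 588),
  (14070545699287, 587), (12950095925895, 586), (11916681236278, 584), (10963707205259, 583),
  (10085065885767, 582), (9275102575355, 580), (8528581302375, 579), (7840656226137, 577),
  (7206841706490, 576), (6622987708040, 575), (6085253859260, 573), (5590088317495, 572),
  (5134205287973, 570), (4714566886083, 569), (4328363658647, 568), (3972999029388, 566),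
  (3646072432125, 565), (3345365983698, 563), (3068829878530, 562), (2814570987591, 560),
  (2580840212973, 559), (2366022741845, 558), (2168627105469, 556), (1987276856363, 555),
  (1820701100652, 553), (1667727404093, 552), (1527273599625, 550), (1398341745571, 549),
  (1280011042268, 547), (1171432692373, 546), (1071823774337, 545), (980462880430, 543),
  (896684817527, 542), (819876908323, 540), (749474411781, 539), (684957390936, 537),
  (625846753120, 536), (571701605655, 534), (522115831195, 533), (476715857290, 531),
  (435157697830, 530), (397125074750, 528), (362326859895, 527), (330495499613, 525),
  (301384802048, 524), (274768617130, 522), (250438925115, 520), (228204732751, 519),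
  (207890420102, 517), (189334822579, 516), (172389800255, 514), (156919475295, 513),
  (142798995930, 511), (129913904637, 510), (118159068427, 508), (107438159466, 506),
  (97662728555, 505), (88751778802, 503), (80630964769, 502), (73232243759, 500),
  (66493182097, 498), (60356673280, 497), (54770336324, 495), (49686288421, 494),
  (45060624582, 492), (40853235313, 490), (37027355200, 489), (33549419497, 487),
  (30388671978, 485), (27517052599, 484), (24908858009, 482), (22540654445, 480),
  (20390982757, 479), (18440293320, 477), (16670689208, 475), (15065878135, 474),
  (13610949895, 472), (12292341831, 470), (11097645016, 469), (10015581680, 467),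
  (9035836076, 465), (8149040695, 464), (7346629512, 462), (6620830889, 460), (5964539504, 458),
  (5371315400, 457), (4835271870, 455), (4351078600, 453), (3913864295, 451), (3519222692, 449),
  (3163127352, 448), (2841940500, 446), (2552338241, 444), (2291320912, 442), (2056148051, 440),
  (1844349560, 439), (1653668665, 437), (1482074143, 435), (1327710076, 433), (1188908248, 431),
  (1064144451, 429), (952050665, 428), (851376628, 426), (761002156, 424), (679903203, 422),
  (607163746, 420), (541946240, 418), (483502844, 416), (431149389, 414), (384276336, 412),
  (342325709, 410), (304801365, 408), (271248950, 406), (241265379, 404), (214481126, 402),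
  (190569292, 400), (169229875, 398), (150198136, 396), (133230930, 394), (118114304, 392),
  (104651419, 390), (92669720, 388), (82010177, 386), (72533807, 384), (64112359, 382),
  (56634173, 380), (49995925, 378), (44108109, 376), (38887673, 374), (34262962, 371),
  (30167357, 369), (26543660, 367), (23338469, 365), (20506255, 363), (18004327, 360),
  (15796476, 358), (13848650, 356), (12132164, 354), (10619863, 351), (9289091, 349),
  (8118264, 347), (7089500, 345), (6185689, 342), (5392783, 340), (4697205, 338), (4087968, 335),
  (3554345, 333), (3087735, 330), (2679689, 328), (2323520, 325), (2012558, 323), (1741630, 320),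
  (1505499, 318), (1300156, 315), (1121505, 313), (966467, 310), (831820, 308), (715220, 305),
  (614154, 302), (526823, 300), (451276, 297), (386155, 294), (329931, 292), (281589, 289),
  (239943, 286), (204226, 283), (173525, 280), (147273, 278), (124754, 275), (105558, 272),
  (89134, 269), (75175, 266), (63261, 263), (53174, 260), (44583, 257), (37338, 253),
  (31185, 250), (26015, 247), (21637, 244), (17977, 240), (14883, 237), (12310, 234),
  (10143, 230), (8349, 227), (6842, 223), (5604, 220), (4565, 216), (3718, 212), (3010, 208),
  (2436, 204), (1958, 200), (1575, 196), (1255, 192), (1002, 188), (792, 184), (627, 179),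
  (490, 175), (385, 170), (297, 165), (231, 160), (176, 155), (135, 150), (101, 145), (77, 139),
  (56, 133), (42, 127), (30, 120), (22, 114), (15, 106), (11, 98), (7, 90), (5, 80), (3, 70),
  (2, 57), (1, 40), (1, 0)]

/-- Sum of products of corresponding entries, the shorter list being padded with zeros. -/
def listDot : List ℕ → List (ℕ × ℕ) → ℕ
  | s :: S, t :: T => s * t.1 + listDot S T
  | _, _ => 0

/-- Every entry, numbered downwards to `0`, satisfies the recurrence that bounds the partition
function from below and the integer inequality that encodes the exponential bound. -/
def tableValid (S : List ℕ) : ℕ → List (ℕ × ℕ) → Bool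
  | 0, [t] => decide (t.1 ≤ 1)
  | n + 1, t :: T => decide ((n + 1) * t.1 ≤ listDot S T) &&
      decide (1600 * (n + 1) ≤ t.2 ^ 2) &&
      decide (27182818286 ^ t.2 < (13 * (n + 1) * t.1) ^ 16 * 10 ^ (10 * t.2)) &&
      tableValid S n T
  | _, _ => false

theorem listDot_le (s c : ℕ → ℕ) : ∀ (S : List ℕ) (T : List (ℕ × ℕ)) (i : ℕ),
    (∀ l, S.getD l 0 ≤ s (i + l)) → (∀ l, (T.getD l (0, 0)).1 ≤ c (i + l)) →
    listDot S T ≤ ∑ l ∈ Finset.range T.length, s (i + l) * c (i + l)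
  | [], T, i, _, _ => by simp [listDot]
  | _ :: _, [], i, _, _ => by simp [listDot]
  | a :: S, t :: T, i, hS, hT => by
    have h := listDot_le s c S T (i + 1)
      (fun l => by simpa [add_assoc, add_comm 1 l] using hS (l + 1))
      (fun l => by simpa [add_assoc, add_comm 1 l] using hT (l + 1))
    rw [List.length_cons, Finset.sum_range_succ', listDot, add_comm]
    refine add_le_add ?_ (Nat.mul_le_mul (hS 0) (hT 0))
    simpa [add_assoc, add_comm 1] using h

theorem getD_divisorSumTable_le (l : ℕ) :
    divisorSumTable.getD l 0 ≤ ∑ d ∈ (l + 1).divisors, d := by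
  -- Truncated subtraction makes `1 - m % (d + 1)` the indicator of divisibility; together with the
  -- `Nat.rec` form below, this gives a closed computation for the kernel.
  have hdiv : ∀ m, ∑ d ∈ m.divisors, d = ∑ d ∈ Finset.range m, (d + 1) * (1 - m % (d + 1)) := by
    intro m
    rw [Nat.divisors, Finset.sum_filter, Finset.sum_Ico_eq_sum_range]
    refine Finset.sum_congr rfl fun d _ => ?_
    rw [add_comm 1 d]
    by_cases h : d + 1 ∣ m
    · simp [h, Nat.mod_eq_zero_of_dvd h]
    · rw [if_neg h, Nat.sub_eq_zero_of_le (Nat.pos_of_ne_zero (mt Nat.dvd_of_mod_eq_zero h)),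
        mul_zero]
  have hrec : ∀ m (k : ℕ), ∑ d ∈ Finset.range k, (d + 1) * (1 - m % (d + 1)) =
      Nat.rec (motive := fun _ => ℕ) 0 (fun d acc => acc + (d + 1) * (1 - m % (d + 1))) k := by
    intro m k
    induction k with
    | zero => rfl
    | succ k ih => rw [Finset.sum_range_succ, ih]
  rw [hdiv, hrec]
  rcases lt_or_ge l 255 with hl | hl
  · have : ∀ l < 255, divisorSumTable.getD l 0 ≤ Nat.rec (motive := fun _ => ℕ) 0
        (fun d acc => acc + (d + 1) * (1 - (l + 1) % (d + 1))) (l + 1) := by decide +kernel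
    exact this l hl
  · have hlen : divisorSumTable.length = 255 := by decide +kernel
    rw [List.getD_eq_default _ _ (by omega)]
    exact Nat.zero_le _

theorem tableValid_partitionTable : tableValid divisorSumTable 255 partitionTable = true := by
  decide +kernel

/-- The table is certified only as a lower bound: its entries satisfy the recurrence with ≤, the
partition function satisfies it with ≥, and induction compares the two. Entries run downwards, so
the tail of the list meets σ(1), σ(2), … in order. -/
theorem getD_le_of_tableValid (n : ℕ) (T : List (ℕ × ℕ))
    (h : tableValid divisorSumTable n T = true) :
    T.length = n + 1 ∧
      ∀ l, (T.getD l (0, 0)).1 ≤ if l ≤ n then Fintype.card (Nat.Partition (n - l)) else 0 := by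
  induction n generalizing T with
  | zero =>
    match T, h with
    | [t], h =>
      have h' : t.1 ≤ 1 := by simpa [tableValid] using h
      refine ⟨rfl, fun l => ?_⟩
      rcases l with _ | l
      · simpa using h'
      · simp
  | succ n ih =>
    match T, h with
    | t :: T, h =>
      simp only [tableValid, Bool.and_eq_true, decide_eq_true_eq] at h
      obtain ⟨hlen, hT⟩ := ih T h.2
      refine ⟨by simp [hlen], fun l => ?_⟩
      rcases l with _ | l
      · have h1 := listDot_le (fun l => ∑ d ∈ (l + 1).divisors, d)
          (fun l => if l ≤ n then Fintype.card (Nat.Partition (n - l)) else 0) divisorSumTable T 0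
          (fun l => by simpa using getD_divisorSumTable_le l) (fun l => by simpa using hT l)
        have h2 := sum_divisors_mul_card_partition_le (n + 1)
        have h3 : ∑ l ∈ Finset.range T.length, (∑ d ∈ (0 + l + 1).divisors, d) *
            (if 0 + l ≤ n then Fintype.card (Nat.Partition (n - (0 + l))) else 0) =
            ∑ m ∈ Finset.Icc 1 (n + 1),
              (∑ d ∈ m.divisors, d) * Fintype.card (Nat.Partition (n + 1 - m)) := by
          rw [hlen, show Finset.Icc 1 (n + 1) = Finset.Ico 1 (n + 2) by ext; simp; omega,
            Finset.sum_Ico_eq_sum_range]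
          refine Finset.sum_congr rfl fun l hl => ?_
          have := Finset.mem_range.1 hl
          rw [if_pos (by omega), show 0 + l + 1 = 1 + l by ring,
            show n + 1 - (1 + l) = n - (0 + l) by omega]
        have h4 := (h.1.1.1.trans h1).trans (h3.le.trans h2)
        simpa using Nat.le_of_mul_le_mul_left h4 (Nat.succ_pos n)
      · simpa using hT l

/-- The 16th power of exp(2.5√n) is exp(40√n), at most e^a when a ≥ 40√n. The decimal bound e <
2.7182818286 then leaves an integer inequality. -/
theorem exp_lt_of_pow_lt {n x a : ℕ} (ha : 1600 * n ≤ a ^ 2)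
    (h : 27182818286 ^ a < (13 * n * x) ^ 16 * 10 ^ (10 * a)) :
    exp (2.5 * √n) < 13 * n * x := by
  have hs : √(n : ℝ) ≤ a / 40 := by
    rw [Real.sqrt_le_left (by positivity), div_pow, le_div_iff₀ (by norm_num)]
    have : (1600 * n : ℝ) ≤ a ^ 2 := by exact_mod_cast ha
    linarith
  refine lt_of_pow_lt_pow_left₀ 16 (by positivity) ?_
  have h' : (27182818286 : ℝ) ^ a < (13 * n * x) ^ 16 * (10 ^ 10) ^ a := by
    rw [← pow_mul]
    exact_mod_cast h
  calc exp (2.5 * √n) ^ 16 = exp (16 * (2.5 * √n)) := by rw [← exp_nat_mul]; norm_num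
    _ ≤ exp (a * 1) := exp_le_exp.2 (by linarith)
    _ = exp 1 ^ a := by rw [exp_nat_mul]
    _ ≤ (27182818286 / 10 ^ 10) ^ a := by
      refine pow_le_pow_left₀ (exp_pos _).le ?_ _
      have := exp_one_lt_d9
      norm_num at this ⊢
      exact this.le
    _ < (13 * n * x) ^ 16 := by
      rw [div_pow, div_lt_iff₀ (by positivity)]
      exact h'

theorem exp_lt_of_tableValid (n : ℕ) (T : List (ℕ × ℕ))
    (h : tableValid divisorSumTable n T = true) (m : ℕ) (hm : 0 < m) (hmn : m ≤ n) :
    exp (2.5 * √m) < 13 * m * Fintype.card (Nat.Partition m) := by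
  induction n generalizing T with
  | zero => omega
  | succ n ih =>
    have hle := (getD_le_of_tableValid _ T h).2 0
    match T, h with
    | t :: T, h =>
      simp only [tableValid, Bool.and_eq_true, decide_eq_true_eq] at h
      rcases Nat.lt_or_ge n m with hlt | hge
      · obtain rfl : m = n + 1 := by omega
        refine (exp_lt_of_pow_lt h.1.1.2 h.1.2).trans_le ?_
        have : (t.1 : ℝ) ≤ Fintype.card (Nat.Partition (n + 1)) := by
          exact_mod_cast (by simpa using hle)
        gcongr
      · exact ih T h.2 hge

theorem exp_lt_card_partition_of_le {n : ℕ} (hn : 0 < n) (hn' : n ≤ 255) :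
    exp (2.5 * √n) < 13 * n * Fintype.card (Nat.Partition n) :=
  exp_lt_of_tableValid 255 _ tableValid_partitionTable n hn hn'

/-! ### Maróti's bound for n ≥ 256: the inductive step. -/

/-- This trades (1 - z)² for the second and fourth powers of 1 - z², which will be m/n. Both ends
are nearly tight: 4.025 at z = 0 and 4.1 at z = 1. -/
theorem four_le_of_mem_Icc {z : ℝ} (h0 : 0 ≤ z) (h1 : z ≤ 1) :
    4 ≤ (1 + z) ^ 2 * (1.025 + 3 * (1 - z ^ 2) ^ 2) := by
  nlinarith [mul_nonneg h0 (sub_nonneg.2 h1), sq_nonneg (z - 1), sq_nonneg (z - 0.95),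
    sq_nonneg (z ^ 2 - 0.9), sq_nonneg (z ^ 3 - 0.85), sq_nonneg (z * (z ^ 2 - 0.9)),
    sq_nonneg (z * (z - 0.95)), mul_nonneg h0 (sq_nonneg (z - 0.95))]

/-- With z = √(n - m)/√n one has z = 1 - (1 - z²)/2 - (1 - z)²/2. The middle term gives the linear
exponent, the last is handled by exp(-t) ≥ 1 - t, and 1/z² ≥ exp(1 - z²) replaces 1/(n - m) by
exp(m/n)/n. The result is an exponential times a polynomial in m, whose sums are known. -/
theorem exp_sqrt_sub_ge {n : ℕ} (m : ℕ) (hm : m < n) :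
    exp (2.5 * √n) / n * (exp (-((1.25 / √n - 1 / n) * m)) *
        (1 - 2.5 * 1.025 / 8 / √n ^ 3 * m ^ 2 - 2.5 * 0.375 / √n ^ 7 * m ^ 4)) ≤
      exp (2.5 * √((n - m : ℕ) : ℝ)) / ((n - m : ℕ) : ℝ) := by
  have hn : (0 : ℝ) < n := by exact_mod_cast (by omega : 0 < n)
  have hmn : (m : ℝ) < n := by exact_mod_cast hm
  have hm0 : (0 : ℝ) ≤ m := m.cast_nonneg
  rw [Nat.cast_sub hm.le]
  set N := √(n : ℝ) with hN
  have hN0 : 0 < N := Real.sqrt_pos.2 hn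
  have hNn : (n : ℝ) = N ^ 2 := (Real.sq_sqrt hn.le).symm
  set z := √((n : ℝ) - m) / N with hz
  have hz0 : 0 < z := div_pos (Real.sqrt_pos.2 (by linarith)) hN0
  have hzz : z ^ 2 * n = n - m := by
    rw [hz, div_pow, Real.sq_sqrt (by linarith), ← hNn]
    field_simp
  have hz1 : z ≤ 1 := by
    have : z ^ 2 ≤ 1 := by
      by_contra hcon
      nlinarith
    nlinarith
  have hs : √((n : ℝ) - m) = N * z := by rw [hz]; field_simp
  have hm' : (m : ℝ) = (1 - z ^ 2) * N ^ 2 := by rw [← hNn]; linarith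
  rw [hs, ← hzz]
  have hpoly : 1 - 2.5 * 1.025 / 8 / N ^ 3 * (m : ℝ) ^ 2 - 2.5 * 0.375 / N ^ 7 * (m : ℝ) ^ 4 ≤
      1 - 2.5 * N * ((1 - z) ^ 2 / 2) := by
    have e1 : 2.5 * 1.025 / 8 / N ^ 3 * (m : ℝ) ^ 2 + 2.5 * 0.375 / N ^ 7 * (m : ℝ) ^ 4 =
        2.5 * N * ((1 - z) ^ 2 / 8) * ((1 + z) ^ 2 * (1.025 + 3 * (1 - z ^ 2) ^ 2)) := by
      rw [hm']
      field_simp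
      ring
    have := mul_le_mul_of_nonneg_left (four_le_of_mem_Icc hz0.le hz1)
      (show 0 ≤ 2.5 * N * ((1 - z) ^ 2 / 8) by positivity)
    linarith
  have hexp : 1 - 2.5 * N * ((1 - z) ^ 2 / 2) ≤ exp (-(2.5 * N * ((1 - z) ^ 2 / 2))) := by
    linarith [add_one_le_exp (-(2.5 * N * ((1 - z) ^ 2 / 2)))]
  have hinv : exp (1 - z ^ 2) ≤ 1 / z ^ 2 := by
    rw [le_div_iff₀ (by positivity)]
    have : z ^ 2 ≤ exp (z ^ 2 - 1) := by linarith [add_one_le_exp (z ^ 2 - 1)]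
    calc exp (1 - z ^ 2) * z ^ 2 ≤ exp (1 - z ^ 2) * exp (z ^ 2 - 1) := by gcongr
      _ = 1 := by rw [← exp_add]; simp
  calc exp (2.5 * N) / n * (exp (-((1.25 / N - 1 / n) * m)) *
        (1 - 2.5 * 1.025 / 8 / N ^ 3 * (m : ℝ) ^ 2 - 2.5 * 0.375 / N ^ 7 * (m : ℝ) ^ 4))
      ≤ exp (2.5 * N) / n * (exp (-((1.25 / N - 1 / n) * m)) *
        exp (-(2.5 * N * ((1 - z) ^ 2 / 2)))) := by
        gcongr
        exact hpoly.trans hexp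
    _ = exp (2.5 * (N * z)) / n * exp (1 - z ^ 2) := by
        have : exp (2.5 * N) * (exp (-((1.25 / N - 1 / n) * m)) *
            exp (-(2.5 * N * ((1 - z) ^ 2 / 2)))) = exp (2.5 * (N * z)) * exp (1 - z ^ 2) := by
          rw [← exp_add, ← exp_add, ← exp_add]
          congr 1
          rw [hm', hNn]
          field_simp
          ring
        rw [div_mul_eq_mul_div, this, div_mul_eq_mul_div]
    _ ≤ exp (2.5 * (N * z)) / n * (1 / z ^ 2) := by gcongr
    _ = _ := by field_simp

/-- Here h = 1/√n. The constants are 0.3203125 = 2.5·1.025/8, 168.75 = 2.5·0.375·180 and 1.6449 <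
π²/6; at h = 0 the claim reads 1.25² < 1.6449. -/
theorem pow_estimate {h : ℝ} (h0 : 0 < h) (h1 : h ≤ 1 / 16) :
    (1.25 - h) ^ 6 * (1 + (2.5 * h + h ^ 2) / 12) <
    ((1.25 - h) ^ 4 - 6.12 * 0.3203125 * h * (1.25 - h) ^ 2 - 168.75 * h ^ 3) *
      (1.6449 - 0.4 * h) := by
  obtain ⟨g, rfl⟩ : ∃ g, h = 1 / 16 - g := ⟨1 / 16 - h, by ring⟩
  have hg0 : 0 ≤ g := by linarith
  have hg1 : g < 1 / 16 := by linarith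
  rw [← sub_pos]
  ring_nf
  nlinarith [pow_nonneg hg0 2, pow_nonneg hg0 3, pow_nonneg hg0 4, pow_nonneg hg0 5]

theorem partition_recurrence_inner_ge {n k : ℕ} (hn : 256 ≤ n) (hk : 0 < k)
    (ih : ∀ m < n, 0 < m → exp (2.5 * √m) / m ≤ 13 * Fintype.card (Nat.Partition m)) :
    exp (2.5 * √n) / n *
      ((1 / (1.25 / √n - 1 / n) ^ 2
        - 2.5 * 1.025 / 8 / √n ^ 3 * (6.12 / (1.25 / √n - 1 / n) ^ 4)
        - 2.5 * 0.375 / √n ^ 7 * (180 / (1.25 / √n - 1 / n) ^ 6)) * (1 / (k : ℝ) ^ 2) - 1 / 12) ≤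
    13 * ∑ j ∈ Finset.Icc 1 n, (if j * k ≤ n then
      (j : ℝ) * Fintype.card (Nat.Partition (n - j * k)) else 0) := by
  have hn0 : (0 : ℝ) < n := by exact_mod_cast (by omega : 0 < n)
  have hN : (16 : ℝ) ≤ √n := by
    rw [Real.le_sqrt (by norm_num) hn0.le]
    have : (256 : ℝ) ≤ n := by exact_mod_cast hn
    linarith
  have hNn : (n : ℝ) = √n ^ 2 := (Real.sq_sqrt hn0.le).symm
  have hexp := fun m hm => exp_sqrt_sub_ge (n := n) m hm
  set τ := 1.25 / √(n : ℝ) - 1 / n with hτ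
  have hτ0 : 0 < τ := by
    rw [hτ, sub_pos]
    conv_lhs => rw [hNn]
    rw [div_lt_div_iff₀ (by positivity) (by positivity)]
    nlinarith
  set b₂ := 2.5 * 1.025 / 8 / √(n : ℝ) ^ 3 with hb₂
  set b₄ := 2.5 * 0.375 / √(n : ℝ) ^ 7 with hb₄
  have hb₂0 : 0 < b₂ := by positivity
  have hb₄0 : 0 < b₄ := by positivity
  set A := exp (2.5 * √(n : ℝ)) / n with hA
  have hA0 : 0 < A := by positivity
  set G : ℝ → ℝ := fun m => exp (-(τ * m)) * (1 - b₂ * m ^ 2 - b₄ * m ^ 4) with hG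
  -- Nonpositivity beyond n lets the finite sum be bounded below by the whole series, and disposes
  -- of the terms with jk ≥ n, where the induction hypothesis is unavailable.
  have hneg : ∀ m : ℕ, n ≤ m → G m ≤ 0 := by
    intro m hm
    refine mul_nonpos_of_nonneg_of_nonpos (exp_pos _).le ?_
    have hm' : (n : ℝ) ≤ m := by exact_mod_cast hm
    have h4 : 1 ≤ b₄ * (m : ℝ) ^ 4 := by
      calc (1 : ℝ) ≤ 2.5 * 0.375 * √(n : ℝ) := by linarith
        _ = b₄ * (n : ℝ) ^ 4 := by
          rw [hb₄]
          conv_rhs => rw [hNn, Real.sqrt_sq (by positivity)]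
          field_simp
        _ ≤ b₄ * (m : ℝ) ^ 4 := by gcongr
    have : 0 ≤ b₂ * (m : ℝ) ^ 2 := by positivity
    linarith
  have hk0 : (0 : ℝ) < k := by exact_mod_cast hk
  have hu : 0 < τ * k := mul_pos hτ0 hk0
  have hsum := ((hasSum_mul_exp_neg hu).sub
    ((hasSum_cube_mul_exp_neg hu).mul_left (b₂ * (k : ℝ) ^ 2))).sub
      ((hasSum_pow_five_mul_exp_neg hu).mul_left (b₄ * (k : ℝ) ^ 4))
  have hsum' : HasSum (fun j : ℕ => (j : ℝ) * G (j * k : ℕ)) _ := hsum.of_eq (fun j => by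
    simp only [hG]
    rw [← exp_nat_mul]
    push_cast
    rw [show (j : ℝ) * -(τ * k) = -(τ * (j * k)) by ring]
    ring) rfl
  have hfin := sum_le_hasSum (Finset.Icc 1 n) (fun j hj => by
    rw [neg_nonneg]
    rcases Nat.eq_zero_or_pos j with rfl | hj0
    · simp
    · refine mul_nonpos_of_nonneg_of_nonpos j.cast_nonneg (hneg _ ?_)
      have : n < j := by
        by_contra hcon
        exact hj (Finset.mem_Icc.2 ⟨hj0, by omega⟩)
      exact this.le.trans (Nat.le_mul_of_pos_right _ hk)) hsum'.neg
  rw [Finset.sum_neg_distrib, neg_le_neg_iff] at hfin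
  have hterm : ∑ j ∈ Finset.Icc 1 n, A * ((j : ℝ) * G (j * k : ℕ)) ≤
      ∑ j ∈ Finset.Icc 1 n, 13 * (if j * k ≤ n then
      (j : ℝ) * Fintype.card (Nat.Partition (n - j * k)) else 0) := by
    refine Finset.sum_le_sum fun j hj => ?_
    have hj0 : (0 : ℝ) ≤ j := j.cast_nonneg
    rcases lt_or_ge (j * k) n with hlt | hge
    · rw [if_pos hlt.le]
      have h1 := hexp (j * k) hlt
      have h2 := ih (n - j * k) (by
        have := Nat.mul_pos (Finset.mem_Icc.1 hj).1 hk
        omega) (by omega)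
      calc A * ((j : ℝ) * G (j * k : ℕ)) = j * (A * G (j * k : ℕ)) := by ring
        _ ≤ j * (13 * Fintype.card (Nat.Partition (n - j * k))) := by
          exact mul_le_mul_of_nonneg_left (h1.trans h2) hj0
        _ = _ := by ring
    · refine le_trans (mul_nonpos_of_nonneg_of_nonpos hA0.le
        (mul_nonpos_of_nonneg_of_nonpos hj0 (hneg _ hge))) ?_
      split_ifs <;> positivity
  rw [← Finset.mul_sum, ← Finset.mul_sum] at hterm
  refine le_trans ?_ hterm
  refine mul_le_mul_of_nonneg_left (le_trans ?_ hfin) hA0.le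
  have m1 := le_exp_neg_div_one_sub_sq hu
  have m2 := mul_le_mul_of_nonneg_left (cube_moment_le hu)
    (show 0 ≤ b₂ * (k : ℝ) ^ 2 by positivity)
  have m3 := mul_le_mul_of_nonneg_left (fifth_moment_le hu)
    (show 0 ≤ b₄ * (k : ℝ) ^ 4 by positivity)
  refine le_trans (le_of_eq ?_) (sub_le_sub (sub_le_sub m1 m2) m3)
  field_simp
  ring

theorem exp_lt_card_partition_of_ge {n : ℕ} (hn : 256 ≤ n)
    (ih : ∀ m < n, 0 < m → exp (2.5 * √m) / m ≤ 13 * Fintype.card (Nat.Partition m)) :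
    exp (2.5 * √n) < 13 * n * Fintype.card (Nat.Partition n) := by
  have hn0 : (0 : ℝ) < n := by exact_mod_cast (by omega : 0 < n)
  have hN : (16 : ℝ) ≤ √n := by
    rw [Real.le_sqrt (by norm_num) hn0.le]
    have : (256 : ℝ) ≤ n := by exact_mod_cast hn
    linarith
  have hinner := fun k (hk : 0 < k) => partition_recurrence_inner_ge hn hk ih
  set N := √(n : ℝ) with hNdef
  have hN0 : 0 < N := by linarith
  have hNn : (n : ℝ) = N ^ 2 := (Real.sq_sqrt hn0.le).symm
  set Q := 1 / (1.25 / N - 1 / n) ^ 2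
        - 2.5 * 1.025 / 8 / N ^ 3 * (6.12 / (1.25 / N - 1 / n) ^ 4)
        - 2.5 * 0.375 / N ^ 7 * (180 / (1.25 / N - 1 / n) ^ 6) with hQ
  -- The cutoff balances two losses: 1/12 for each k used, and a tail of ζ(2) of at most 1/K
  -- multiplied by Q, which is of order N².
  set K := ⌈2.5 * N⌉₊ with hK
  have hK0 : 0 < K := Nat.ceil_pos.2 (by positivity)
  have hK1 : 2.5 * N ≤ K := Nat.le_ceil _
  have hK2 : (K : ℝ) ≤ 2.5 * N + 1 := (Nat.ceil_lt_add_one (by positivity)).le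
  set A := exp (2.5 * N) / n with hA
  have hA0 : 0 < A := by positivity
  have hrec : (∑ k ∈ Finset.Icc 1 K, ∑ j ∈ Finset.Icc 1 n, (if j * k ≤ n then
      (j : ℝ) * Fintype.card (Nat.Partition (n - j * k)) else 0)) ≤
      n * Fintype.card (Nat.Partition n) := by
    have := sum_mul_card_partition_le n K
    exact_mod_cast this
  have hlow : A * (Q * ∑ k ∈ Finset.Icc 1 K, 1 / (k : ℝ) ^ 2 - K * (1 / 12)) ≤
      13 * ∑ k ∈ Finset.Icc 1 K, ∑ j ∈ Finset.Icc 1 n, (if j * k ≤ n then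
      (j : ℝ) * Fintype.card (Nat.Partition (n - j * k)) else 0) := by
    rw [Finset.mul_sum, Finset.mul_sum]
    have : (K : ℝ) * (1 / 12) = ∑ k ∈ Finset.Icc 1 K, (1 / 12 : ℝ) := by simp
    rw [this, ← Finset.sum_sub_distrib, Finset.mul_sum]
    exact Finset.sum_le_sum fun k hk => hinner k (Finset.mem_Icc.1 hk).1
  set h := 1 / N with hh
  have hh0 : 0 < h := by positivity
  have hh1 : h ≤ 1 / 16 := one_div_le_one_div_of_le (by norm_num) hN
  have hv : 0 < 1.25 - h := by linarith
  have hest := pow_estimate hh0 hh1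
  have hQ' : Q = N ^ 2 * (((1.25 - h) ^ 4 - 6.12 * 0.3203125 * h * (1.25 - h) ^ 2 -
      168.75 * h ^ 3) / (1.25 - h) ^ 6) := by
    have e : 1.25 / N - 1 / n = (1.25 - h) / N := by
      rw [hNn, hh]
      field_simp
    rw [hQ, e, hh] at *
    field_simp
    ring
  have hpoly : N ^ 2 * (1 + (2.5 * h + h ^ 2) / 12) < Q * (1.6449 - 0.4 * h) := by
    rw [hQ', mul_assoc, div_mul_eq_mul_div]
    refine mul_lt_mul_of_pos_left ?_ (by positivity)
    rw [lt_div_iff₀ (by positivity)]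
    linarith
  have hQ0 : 0 < Q := by
    have h1 : 0 < Q * (1.6449 - 0.4 * h) := lt_trans (by positivity) hpoly
    exact (pos_iff_pos_of_mul_pos h1).2 (by linarith)
  have hfinal : (n : ℝ) < Q * ∑ k ∈ Finset.Icc 1 K, 1 / (k : ℝ) ^ 2 - K * (1 / 12) := by
    have z := pi_sq_div_six_sub_le K hK0
    have hpi : (1.6449 : ℝ) ≤ π ^ 2 / 6 := by nlinarith [Real.pi_gt_d6]
    have hKinv : 1 / (K : ℝ) ≤ 0.4 * h := by
      calc 1 / (K : ℝ) ≤ 1 / (2.5 * N) := one_div_le_one_div_of_le (by positivity) hK1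
        _ = 0.4 * h := by rw [hh]; field_simp; norm_num
    have h1 : Q * (1.6449 - 0.4 * h) ≤ Q * ∑ k ∈ Finset.Icc 1 K, 1 / (k : ℝ) ^ 2 := by
      gcongr
      linarith
    have h2 : N ^ 2 * (1 + (2.5 * h + h ^ 2) / 12) = n + (2.5 * N + 1) / 12 := by
      rw [hNn, hh]
      field_simp
    linarith
  have hmul : A * n < 13 * (n * Fintype.card (Nat.Partition n)) :=
    lt_of_lt_of_le (mul_lt_mul_of_pos_left hfinal hA0)
      (hlow.trans (mul_le_mul_of_nonneg_left hrec (by norm_num)))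
  have hAn : A * n = exp (2.5 * N) := by rw [hA]; field_simp
  rw [← hAn]
  linarith

/-- Maróti's lower bound for the number of partitions. -/
theorem exp_div_lt_card_partition {n : ℕ} (hn : 0 < n) :
    exp (2.5 * √n) / (13 * n) < Fintype.card (Nat.Partition n) := by
  induction n using Nat.strong_induction_on with
  | _ n ih =>
    have hn0 : (0 : ℝ) < n := by exact_mod_cast hn
    rw [div_lt_iff₀ (by positivity), mul_comm (Fintype.card _ : ℝ)]
    rcases Nat.lt_or_ge n 256 with h | h
    · exact exp_lt_card_partition_of_le hn (by omega)
    · refine exp_lt_card_partition_of_ge h fun m hm hm0 => ?_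
      have hm' : (0 : ℝ) < m := by exact_mod_cast hm0
      have := (ih m hm hm0).le
      rw [div_le_iff₀ (by positivity)] at this ⊢
      linarith

end PartitionBound

/-! ### Multiplicative independence of the binomials. -/

section Orders

open Polynomial

/-- Let d be the order of α and ω a primitive md-th root of unity. Then α = (ω^m)^i with i prime to
d; units modulo d lift to units v modulo md, and ω^v works. -/
theorem exists_orderOf_eq_mul_and_pow_eq {L : Type*} [Field L] [IsAlgClosed L] (α : L) (m : ℕ)
    (hm : ((m * orderOf α : ℕ) : L) ≠ 0) : ∃ x : L, orderOf x = m * orderOf α ∧ x ^ m = α := by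
  set d := orderOf α with hd
  have hmd : m * d ≠ 0 := fun h => hm (by simp [h])
  have : NeZero ((m * d : ℕ) : L) := ⟨hm⟩
  have : NeZero (m * d) := ⟨hmd⟩
  have : NeZero d := ⟨fun h => hmd (by simp [h])⟩
  obtain ⟨ω, hω⟩ := HasEnoughRootsOfUnity.exists_primitiveRoot L (m * d)
  have hωm : IsPrimitiveRoot (ω ^ m) d := hω.pow (Nat.pos_of_ne_zero hmd) rfl
  obtain ⟨i, -, hi, hiα⟩ := hωm.isPrimitiveRoot_iff.1 (IsPrimitiveRoot.orderOf α)
  obtain ⟨v, hv⟩ := ZMod.unitsMap_surjective (Dvd.intro_left m rfl : d ∣ m * d)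
    (ZMod.unitOfCoprime i hi)
  have hvi : (v : ZMod (m * d)).val ≡ i [MOD d] := by
    rw [← ZMod.natCast_eq_natCast_iff]
    have := congrArg (Units.val) hv
    rw [ZMod.unitsMap_val, ZMod.coe_unitOfCoprime] at this
    rw [← this, ZMod.natCast_val]
  refine ⟨ω ^ (v : ZMod (m * d)).val, ?_, ?_⟩
  · exact ((hω.pow_of_coprime _ (ZMod.val_coe_unit_coprime v)).eq_orderOf).symm
  · rw [← pow_mul, mul_comm, pow_mul, ← hiα]
    exact pow_eq_pow_of_modEq hvi hωm.pow_eq_one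

/-- Products over multisets determine the multiset if every factor can be annihilated without
annihilating any other factor of at most the same rank. -/
theorem Multiset.eq_of_prod_map_eq {ι R L : Type*} [CommRing R] [IsDomain R] [Field L]
    (P : ι → R) (rank : ι → ℕ) (S : Set ι) (hP : ∀ i ∈ S, P i ≠ 0)
    (hsep : ∀ i ∈ S, ∃ φ : R →+* L, φ (P i) = 0 ∧
      ∀ j ∈ S, rank j ≤ rank i → φ (P j) = 0 → j = i) (s : Multiset ι) :
    ∀ t : Multiset ι, (∀ i ∈ s, i ∈ S) → (∀ i ∈ t, i ∈ S) →
      (s.map P).prod = (t.map P).prod → s = t := by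
  classical
  -- The homomorphism that kills the factor at i kills the product over s, hence a factor from t,
  -- which must be i itself. Applied to an index of maximal rank, this allows cancellation and
  -- induction.
  have key : ∀ s t : Multiset ι, (∀ i ∈ s, i ∈ S) → (∀ i ∈ t, i ∈ S) →
      (s.map P).prod = (t.map P).prod → ∀ i ∈ s, (∀ j ∈ t, rank j ≤ rank i) → i ∈ t := by
    intro s t hs ht h i hi hmax
    obtain ⟨φ, h0, hφ⟩ := hsep i (hs i hi)
    have hz : φ (t.map P).prod = 0 := by
      rw [← h, map_multiset_prod, Multiset.map_map]
      exact Multiset.prod_eq_zero (Multiset.mem_map.2 ⟨i, hi, h0⟩)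
    rw [map_multiset_prod, Multiset.map_map, Multiset.prod_eq_zero_iff, Multiset.mem_map] at hz
    obtain ⟨j, hj, hj0⟩ := hz
    rwa [← hφ j (ht j hj) (hmax j hj) hj0]
  induction hn : s.card using Nat.strong_induction_on generalizing s with
  | _ n ih =>
    intro t hs ht h
    by_cases hst : (s + t).toFinset.Nonempty
    · obtain ⟨i, hi, hmax⟩ := (s + t).toFinset.exists_max_image rank hst
      simp only [Multiset.mem_toFinset, Multiset.mem_add] at hi hmax
      have hboth : i ∈ s ∧ i ∈ t := by
        rcases hi with hi | hi
        · exact ⟨hi, key s t hs ht h i hi fun j hj => hmax j (Or.inr hj)⟩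
        · exact ⟨key t s ht hs h.symm i hi fun j hj => hmax j (Or.inl hj), hi⟩
      obtain ⟨s', rfl⟩ := Multiset.exists_cons_of_mem hboth.1
      obtain ⟨t', rfl⟩ := Multiset.exists_cons_of_mem hboth.2
      rw [ih s'.card (by rw [← hn]; simp) s' rfl t'
        (fun j hj => hs j (Multiset.mem_cons_of_mem hj))
        (fun j hj => ht j (Multiset.mem_cons_of_mem hj))]
      simp only [Multiset.map_cons, Multiset.prod_cons] at h
      exact mul_left_cancel₀ (hP i (hs i hboth.1)) h
    · rw [Finset.not_nonempty_iff_eq_empty, Multiset.toFinset_eq_empty,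
        add_eq_zero] at hst
      rw [hst.1, hst.2]

/-- The polynomial `X ^ m + a`, or its reciprocal polynomial `a X ^ m + 1`. -/
noncomputable def binomialFactor {F : Type*} [Field F] (a : F) : ℕ × Bool → F[X]
  | (m, false) => X ^ m + C a
  | (m, true) => C a * X ^ m + 1

section Independence

variable {F : Type*} [Field F] {a : F}

theorem binomialFactor_ne_zero {i : ℕ × Bool} (hi : 0 < i.1) : binomialFactor a i ≠ 0 := by
  rcases i with ⟨m, _ | _⟩
  · exact X_pow_add_C_ne_zero hi a
  · intro h
    have := congrArg (eval 0) h
    simp [binomialFactor, hi.ne'] at this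

theorem natDegree_prod_binomialFactor_le (s : Multiset (ℕ × Bool)) :
    (s.map (binomialFactor a)).prod.natDegree ≤ (s.map Prod.fst).sum := by
  induction s using Multiset.induction with
  | empty => simp
  | cons i s ih =>
    simp only [Multiset.map_cons, Multiset.prod_cons, Multiset.sum_cons]
    refine natDegree_mul_le.trans (add_le_add ?_ ih)
    rcases i with ⟨m, _ | _⟩ <;> simp only [binomialFactor] <;> compute_degree

/-- The separating point for X^m + a is an x with x^m = -a of order m·ord(-a); x^l = (-a)^(±1) with
0 < l < m would make the order too small. Its inverse serves aX^m + 1, and at equal exponent a² ≠ 1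
distinguishes the two kinds. -/
theorem eq_of_prod_binomialFactor_eq [Finite F] (ha : a ≠ 0) (s t : Multiset (ℕ × Bool))
    (hs : ∀ i ∈ s, (i.1 : F) ≠ 0 ∧ (i.2 = true → a ^ 2 ≠ 1))
    (ht : ∀ i ∈ t, (i.1 : F) ≠ 0 ∧ (i.2 = true → a ^ 2 ≠ 1))
    (h : (s.map (binomialFactor a)).prod = (t.map (binomialFactor a)).prod) : s = t := by
  have : Fintype F := Fintype.ofFinite F
  set ι := algebraMap F (AlgebraicClosure F) with hι
  have hιinj : Function.Injective ι := ι.injective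
  set b := ι a with hb
  have hb0 : b ≠ 0 := by rw [hb, map_ne_zero_iff _ hιinj]; exact ha
  have hord : orderOf (-b) = orderOf (-a) := by
    rw [hb, ← map_neg]
    exact orderOf_injective (ι : F →* AlgebraicClosure F) hιinj (-a)
  have hd1 : (-a) ^ (Fintype.card F - 1) = 1 :=
    FiniteField.pow_card_sub_one_eq_one _ (neg_ne_zero.2 ha)
  -- The order divides |F| - 1, whose image in F is -1.
  have hd0 : ((orderOf (-a) : ℕ) : F) ≠ 0 := by
    obtain ⟨c, hc⟩ := orderOf_dvd_of_pow_eq_one hd1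
    intro h0
    have h1 := congrArg (Nat.cast : ℕ → F) hc
    rw [Nat.cast_sub Fintype.card_pos, Nat.cast_mul, h0] at h1
    simp at h1
  have hdpos : 0 < orderOf (-b) := by
    rw [hord]
    exact Nat.pos_of_ne_zero fun h0 => hd0 (by simp [h0])
  have hpoint : ∀ m : ℕ, (m : F) ≠ 0 → ∃ x : AlgebraicClosure F, x ^ m = -b ∧
      ∀ l, 0 < l → l < m → x ^ l ≠ -b ∧ x ^ l ≠ (-b)⁻¹ := by
    intro m hm
    obtain ⟨x, hx, hxm⟩ := exists_orderOf_eq_mul_and_pow_eq (-b) m (by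
      rw [hord, ← map_natCast ι, map_ne_zero_iff _ hιinj, Nat.cast_mul]
      exact mul_ne_zero hm hd0)
    have hne : ∀ l, 0 < l → l < m → (x ^ l) ^ orderOf (-b) ≠ 1 := by
      intro l hl hlm h1
      rw [← pow_mul] at h1
      have h2 := Nat.le_of_dvd (Nat.mul_pos hl hdpos) (orderOf_dvd_of_pow_eq_one h1)
      rw [hx] at h2
      exact absurd (Nat.le_of_mul_le_mul_right h2 hdpos) (by omega)
    refine ⟨x, hxm, fun l hl hlm => ⟨fun h1 => ?_, fun h1 => ?_⟩⟩ <;>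
      refine hne l hl hlm ?_ <;> rw [h1]
    · exact pow_orderOf_eq_one _
    · rw [inv_pow, pow_orderOf_eq_one, inv_one]
  have hpos : ∀ {m : ℕ}, (m : F) ≠ 0 → 0 < m := fun {m} hm =>
    Nat.pos_of_ne_zero fun h0 => hm (by simp [h0])
  have hsq : a ^ 2 ≠ 1 → (-b) ≠ (-b)⁻¹ := by
    intro h1 h2
    apply h1
    apply hιinj
    rw [map_pow, map_one, ← hb]
    have h3 : (-b) * (-b) = 1 := by
      nth_rewrite 2 [h2]
      exact mul_inv_cancel₀ (neg_ne_zero.2 hb0)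
    linear_combination h3
  have hF : ∀ (x : AlgebraicClosure F) (m : ℕ),
      eval₂RingHom ι x (binomialFactor a (m, false)) = 0 ↔ x ^ m = -b := by
    intro x m
    simp [binomialFactor, ← hb, eq_neg_iff_add_eq_zero]
  have hT : ∀ (x : AlgebraicClosure F) (m : ℕ),
      eval₂RingHom ι x (binomialFactor a (m, true)) = 0 ↔ x ^ m = (-b)⁻¹ := by
    intro x m
    simp only [binomialFactor, coe_eval₂RingHom, eval₂_add, eval₂_mul, eval₂_C, eval₂_pow, eval₂_X,
      eval₂_one, ← hb]
    rw [inv_neg, eq_neg_iff_add_eq_zero]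
    constructor
    · intro h1
      field_simp
      linear_combination h1
    · intro h1
      field_simp at h1
      linear_combination h1
  refine Multiset.eq_of_prod_map_eq (L := AlgebraicClosure F) (binomialFactor a) Prod.fst
    {i | (i.1 : F) ≠ 0 ∧ (i.2 = true → a ^ 2 ≠ 1)}
    (fun i hi => binomialFactor_ne_zero (hpos hi.1)) ?_ s t hs ht h
  rintro ⟨m, c⟩ ⟨hm, hc⟩
  obtain ⟨x, hxm, hx⟩ := hpoint m hm
  have hinv : ∀ {l : ℕ} {y : AlgebraicClosure F}, x⁻¹ ^ l = y → x ^ l = y⁻¹ := by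
    intro l y h1
    rw [← h1, inv_pow, inv_inv]
  rcases c with _ | _
  · refine ⟨eval₂RingHom ι x, (hF x m).2 hxm, ?_⟩
    rintro ⟨l, c⟩ ⟨hl, hlc⟩ hle h0
    rcases (show l ≤ m from hle).lt_or_eq with hlt | rfl
    · rcases c with _ | _
      · exact absurd ((hF _ _).1 h0) (hx l (hpos hl) hlt).1
      · exact absurd ((hT _ _).1 h0) (hx l (hpos hl) hlt).2
    · rcases c with _ | _
      · rfl
      · exact absurd (hxm.symm.trans ((hT _ _).1 h0)) (hsq (hlc rfl))
  · refine ⟨eval₂RingHom ι x⁻¹, (hT _ m).2 (by rw [inv_pow, hxm]), ?_⟩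
    rintro ⟨l, c⟩ ⟨hl, hlc⟩ hle h0
    rcases (show l ≤ m from hle).lt_or_eq with hlt | rfl
    · rcases c with _ | _
      · exact absurd (hinv ((hF _ _).1 h0)) (hx l (hpos hl) hlt).2
      · exact absurd (by simpa using hinv ((hT _ _).1 h0)) (hx l (hpos hl) hlt).1
    · rcases c with _ | _
      · exact absurd (hxm.symm.trans (hinv ((hF _ _).1 h0))) (hsq (hc rfl))
      · rfl

end Independence

/-! ### Products of Frobenius conjugates and lower bounds for orders. -/

theorem card_le_orderOf {K T : Type*} [Field K] [Finite K] [Fintype T] {g : K} (hg : g ≠ 0)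
    (φ : T → K) (hφ : Function.Injective φ) (hmem : ∀ t, φ t ∈ Submonoid.powers g) :
    Fintype.card T ≤ orderOf g := by
  classical
  have hpos : 0 < orderOf g := by
    rw [← Units.val_mk0 hg, orderOf_units]
    exact orderOf_pos _
  calc Fintype.card T = (Finset.univ.image φ).card := by
        rw [Finset.card_image_of_injective _ hφ, Finset.card_univ]
    _ ≤ ((Finset.range (orderOf g)).image (g ^ ·)).card := by
        refine Finset.card_le_card fun x hx => ?_
        obtain ⟨t, -, rfl⟩ := Finset.mem_image.1 hx
        obtain ⟨k, hk⟩ := hmem t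
        exact Finset.mem_image.2 ⟨k % orderOf g, Finset.mem_range.2 (Nat.mod_lt _ hpos), by
          simpa [pow_mod_orderOf] using hk⟩
    _ ≤ orderOf g := Finset.card_image_le.trans (by simp)

theorem exists_pow_modEq {q r : ℕ} (hr : r.Prime) (hq : orderOf (q : ZMod r) = r - 1) {m : ℕ}
    (hm : m.Coprime r) : ∃ i, q ^ i ≡ m [MOD r] := by
  have : Fact r.Prime := ⟨hr⟩
  have hq0 : (q : ZMod r) ≠ 0 := by
    intro h0
    rw [h0, orderOf_zero] at hq
    have := hr.two_le
    omega
  set u := Units.mk0 (q : ZMod r) hq0 with hu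
  have hu' : orderOf u = r - 1 := by rw [← orderOf_units, hu, Units.val_mk0, hq]
  have htop : Subgroup.zpowers u = ⊤ := by
    apply Subgroup.eq_top_of_card_eq
    rw [Nat.card_zpowers, hu', Nat.card_eq_fintype_card, ZMod.card_units]
  have hmem : ZMod.unitOfCoprime m hm ∈ Subgroup.zpowers u := by rw [htop]; trivial
  rw [← mem_powers_iff_mem_zpowers] at hmem
  obtain ⟨i, hi⟩ := hmem
  refine ⟨i, ?_⟩
  rw [← ZMod.natCast_eq_natCast_iff]
  have := congrArg Units.val hi
  simpa [hu] using this

/-- Labels every element of a multiset with the same truth value. -/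
def Multiset.label {ι : Type*} (b : Bool) (s : Multiset ι) : Multiset (ι × Bool) :=
  s.map fun i => (i, b)

theorem Multiset.label_add_label_inj {ι : Type*} {s t s' t' : Multiset ι}
    (h : s.label false + t.label true = s'.label false + t'.label true) : s = s' ∧ t = t' := by
  constructor
  · have := congrArg (fun M => (M.filter (fun i => i.2 = false)).map Prod.fst) h
    simpa [Multiset.label, Multiset.filter_add, Multiset.filter_map, Function.comp_def] using this
  · have := congrArg (fun M => (M.filter (fun i => i.2 = true)).map Prod.fst) h
    simpa [Multiset.label, Multiset.filter_add, Multiset.filter_map, Function.comp_def] using this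

section Frobenius

variable {F K : Type*} [Field F] [Field K] [Algebra F K] {r : ℕ} {ζ : K}

theorem prod_pow_zpow_mul_add (ζ : K) (a : F) (e : ℤ) (s : Multiset ℕ) :
    (s.map fun m => (ζ ^ m) ^ e * (ζ ^ m + algebraMap F K a)).prod =
      (ζ ^ s.sum) ^ e * aeval ζ ((s.label false).map (binomialFactor a)).prod := by
  induction s using Multiset.induction with
  | empty => simp [Multiset.label]
  | cons m s ih =>
    simp only [Multiset.label, Multiset.map_cons, Multiset.prod_cons, Multiset.sum_cons,
      map_mul] at ih ⊢
    rw [ih, pow_add, mul_zpow]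
    simp only [binomialFactor, map_add, map_pow, aeval_X, aeval_C]
    ring

/-- Because ζ^(-m) + a = ζ^(-m)(aζ^m + 1), the exponent e becomes e + 1. The prefactor again depends
only on the sum of s, so it cancels between partitions of the same number. -/
theorem prod_inv_pow_zpow_mul_add (hζ : ζ ≠ 0) (a : F) (e : ℤ) (s : Multiset ℕ) :
    (s.map fun m => ((ζ ^ m)⁻¹) ^ e * ((ζ ^ m)⁻¹ + algebraMap F K a)).prod =
      (ζ ^ s.sum)⁻¹ ^ (e + 1) * aeval ζ ((s.label true).map (binomialFactor a)).prod := by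
  induction s using Multiset.induction with
  | empty => simp [Multiset.label]
  | cons m s ih =>
    simp only [Multiset.label, Multiset.map_cons, Multiset.prod_cons, Multiset.sum_cons,
      map_mul] at ih ⊢
    rw [ih, pow_add, mul_inv, mul_zpow, zpow_add_one₀ (inv_ne_zero (pow_ne_zero m hζ))]
    simp only [binomialFactor, map_add, map_mul, map_pow, map_one, aeval_X, aeval_C]
    have : ζ ^ m ≠ 0 := pow_ne_zero m hζ
    have h1 : (ζ ^ m)⁻¹ + algebraMap F K a = (ζ ^ m)⁻¹ * (algebraMap F K a * ζ ^ m + 1) := by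
      field_simp
      ring
    rw [h1]
    ring

theorem prod_mul_inv (ζ : K) (a : F) (s : Multiset ℕ) :
    (s.map fun m => (algebraMap F K a * ζ ^ m + 1) * (ζ ^ m + algebraMap F K a)⁻¹).prod =
      aeval ζ ((s.label true).map (binomialFactor a)).prod *
        (aeval ζ ((s.label false).map (binomialFactor a)).prod)⁻¹ := by
  induction s using Multiset.induction with
  | empty => simp [Multiset.label]
  | cons m s ih =>
    simp only [Multiset.label, Multiset.map_cons, Multiset.prod_cons, map_mul] at ih ⊢
    rw [ih]
    simp only [binomialFactor, map_add, map_mul, map_pow, map_one, aeval_X, aeval_C, mul_inv]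
    ring

variable [Fintype F]

theorem frobeniusAlgHom_pow_apply (i : ℕ) (x : K) :
    (FiniteField.frobeniusAlgHom F K ^ i) x = x ^ Fintype.card F ^ i := by
  induction i with
  | zero => simp
  | succ i ih =>
    rw [pow_succ', AlgHom.mul_apply, ih, FiniteField.coe_frobeniusAlgHom, pow_succ, pow_mul]

theorem exists_frobenius_pow_eq_pow (hr : r.Prime)
    (hq : orderOf ((Fintype.card F : ℕ) : ZMod r) = r - 1) (hζ : IsPrimitiveRoot ζ r) {m : ℕ}
    (hm : m.Coprime r) :
    ∃ i, (FiniteField.frobeniusAlgHom F K ^ i) ζ = ζ ^ m := by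
  obtain ⟨i, hi⟩ := exists_pow_modEq hr hq hm
  exact ⟨i, by rw [frobeniusAlgHom_pow_apply, pow_eq_pow_of_modEq hi hζ.pow_eq_one]⟩

theorem exists_frobenius_pow_eq_inv (hr : r.Prime)
    (hq : orderOf ((Fintype.card F : ℕ) : ZMod r) = r - 1) (hζ : IsPrimitiveRoot ζ r) {m : ℕ}
    (hm0 : 0 < m) (hm : m < r) :
    ∃ i, (FiniteField.frobeniusAlgHom F K ^ i) ζ = (ζ ^ m)⁻¹ := by
  obtain ⟨i, hi⟩ := exists_frobenius_pow_eq_pow hr hq hζ (m := r - m)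
    (Nat.coprime_of_lt_prime (by omega) (by omega) hr).symm
  refine ⟨i, hi.trans (eq_inv_of_mul_eq_one_left ?_)⟩
  rw [← pow_add, Nat.sub_add_cancel hm.le, hζ.pow_eq_one]

/-- Frobenius carries the root ζ of P to all of ζ, …, ζ^(r-1), which are r - 1 distinct roots. -/
theorem eq_zero_of_aeval_eq_zero (hr : r.Prime)
    (hq : orderOf ((Fintype.card F : ℕ) : ZMod r) = r - 1) (hζ : IsPrimitiveRoot ζ r)
    {P : F[X]} (hP : aeval ζ P = 0) (hdeg : P.natDegree < r - 1) : P = 0 := by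
  classical
  have hinj : Function.Injective (algebraMap F K) := (algebraMap F K).injective
  rw [← Polynomial.map_eq_zero_iff hinj]
  refine eq_zero_of_natDegree_lt_card_of_eval_eq_zero' _ ((Finset.Ico 1 r).image (ζ ^ ·)) ?_ ?_
  · intro x hx
    obtain ⟨m, hm, rfl⟩ := Finset.mem_image.1 hx
    rw [Finset.mem_Ico] at hm
    obtain ⟨i, hi⟩ := exists_frobenius_pow_eq_pow (F := F) hr hq hζ
      (Nat.coprime_of_lt_prime (by omega) hm.2 hr).symm
    rw [eval_map_algebraMap, ← hi, aeval_algHom_apply, hP, map_zero]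
  · rw [natDegree_map, Finset.card_image_of_injOn, Nat.card_Ico]
    · exact hdeg
    · intro m hm n hn h
      simp only [Finset.coe_Ico, Set.mem_Ico] at hm hn
      exact hζ.pow_inj hm.2 hn.2 h

theorem eq_of_aeval_prod_binomialFactor_eq (hr : r.Prime)
    (hq : orderOf ((Fintype.card F : ℕ) : ZMod r) = r - 1) (hζ : IsPrimitiveRoot ζ r)
    {a : F} (ha : a ≠ 0) (s t : Multiset (ℕ × Bool))
    (hs : ∀ i ∈ s, (i.1 : F) ≠ 0 ∧ (i.2 = true → a ^ 2 ≠ 1))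
    (ht : ∀ i ∈ t, (i.1 : F) ≠ 0 ∧ (i.2 = true → a ^ 2 ≠ 1))
    (hsdeg : (s.map Prod.fst).sum < r - 1) (htdeg : (t.map Prod.fst).sum < r - 1)
    (h : aeval ζ (s.map (binomialFactor a)).prod = aeval ζ (t.map (binomialFactor a)).prod) :
    s = t := by
  refine eq_of_prod_binomialFactor_eq ha s t hs ht (sub_eq_zero.1 ?_)
  refine eq_zero_of_aeval_eq_zero hr hq hζ (by rw [map_sub, h, sub_self]) ?_
  exact (natDegree_sub_le _ _).trans_lt (max_lt
    ((natDegree_prod_binomialFactor_le s).trans_lt hsdeg)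
    ((natDegree_prod_binomialFactor_le t).trans_lt htdeg))

theorem aeval_prod_binomialFactor_ne_zero (hr : r.Prime)
    (hq : orderOf ((Fintype.card F : ℕ) : ZMod r) = r - 1) (hζ : IsPrimitiveRoot ζ r)
    (a : F) (s : Multiset (ℕ × Bool)) (hs : ∀ i ∈ s, 0 < i.1)
    (hsdeg : (s.map Prod.fst).sum < r - 1) :
    aeval ζ (s.map (binomialFactor a)).prod ≠ 0 := by
  intro h
  have h0 := eq_zero_of_aeval_eq_zero hr hq hζ h
    ((natDegree_prod_binomialFactor_le s).trans_lt hsdeg)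
  rw [Multiset.prod_eq_zero_iff, Multiset.mem_map] at h0
  obtain ⟨i, hi, hi0⟩ := h0
  exact binomialFactor_ne_zero (hs i hi) hi0

theorem frobeniusAlgHom_pow_mem_powers (g : K) (i : ℕ) :
    (FiniteField.frobeniusAlgHom F K ^ i) g ∈ Submonoid.powers g :=
  ⟨_, (frobeniusAlgHom_pow_apply i g).symm⟩

theorem add_algebraMap_ne_zero (hr : r.Prime)
    (hq : orderOf ((Fintype.card F : ℕ) : ZMod r) = r - 1) (hζ : IsPrimitiveRoot ζ r)
    (hr2 : 2 < r) (a : F) : ζ + algebraMap F K a ≠ 0 := by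
  have := aeval_prod_binomialFactor_ne_zero hr hq hζ a {(1, false)} (by simp)
    (by simp; omega)
  simpa [binomialFactor] using this

variable [Finite K]

/-- The order of `ζ ^ e * (ζ + a)` is at least the number of partitions of `n`. -/
theorem card_partition_le_orderOf (hr : r.Prime)
    (hq : orderOf ((Fintype.card F : ℕ) : ZMod r) = r - 1) (hζ : IsPrimitiveRoot ζ r)
    (hr2 : 2 < r) {a : F} (ha : a ≠ 0) (e : ℤ) {n : ℕ} (hn : n < r - 1)
    (hchar : ∀ m, 0 < m → m ≤ n → (m : F) ≠ 0) :
    Fintype.card (Nat.Partition n) ≤ orderOf (ζ ^ e * (ζ + algebraMap F K a)) := by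
  have hζ0 : ζ ≠ 0 := hζ.ne_zero hr.ne_zero
  refine card_le_orderOf (mul_ne_zero (zpow_ne_zero _ hζ0) (add_algebraMap_ne_zero hr hq hζ hr2 a))
    (fun l : Nat.Partition n =>
      (l.parts.map fun m => (ζ ^ m) ^ e * (ζ ^ m + algebraMap F K a)).prod) ?_ ?_
  · intro l l' h
    simp only [prod_pow_zpow_mul_add, l.parts_sum, l'.parts_sum] at h
    have h' := mul_left_cancel₀ (zpow_ne_zero _ (pow_ne_zero _ hζ0)) h
    have hmem : ∀ l : Nat.Partition n, ∀ i ∈ l.parts.label false,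
        (i.1 : F) ≠ 0 ∧ (i.2 = true → a ^ 2 ≠ 1) := by
      intro l i hi
      obtain ⟨m, hm, rfl⟩ := Multiset.mem_map.1 hi
      refine ⟨hchar m (l.parts_pos hm) ?_, by simp⟩
      exact (Multiset.single_le_sum (fun _ _ => Nat.zero_le _) _ hm).trans l.parts_sum.le
    have hdeg : ∀ l : Nat.Partition n, ((l.parts.label false).map Prod.fst).sum < r - 1 := by
      intro l
      simpa [Multiset.label, l.parts_sum] using hn
    have := eq_of_aeval_prod_binomialFactor_eq hr hq hζ ha _ _ (hmem l) (hmem l') (hdeg l)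
      (hdeg l') h'
    exact Nat.Partition.ext (Multiset.label_add_label_inj (t := 0) (t' := 0)
      (by rw [this])).1
  · intro l
    refine Submonoid.multiset_prod_mem _ _ fun x hx => ?_
    obtain ⟨m, hm, rfl⟩ := Multiset.mem_map.1 hx
    have hmn : m ≤ n := (Multiset.single_le_sum (fun _ _ => Nat.zero_le _) _ hm).trans
      l.parts_sum.le
    obtain ⟨i, hi⟩ := exists_frobenius_pow_eq_pow (F := F) hr hq hζ
      (Nat.coprime_of_lt_prime (l.parts_pos hm).ne' (by omega) hr).symm
    have := frobeniusAlgHom_pow_mem_powers (F := F) (ζ ^ e * (ζ + algebraMap F K a)) i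
    rwa [map_mul, map_zpow₀, map_add, hi, AlgHom.commutes] at this

/-- If `a ^ 2 ≠ 1`, the order of `ζ ^ e * (ζ + a)` is at least the square of the number of
partitions of `n`. -/
theorem card_partition_sq_le_orderOf (hr : r.Prime)
    (hq : orderOf ((Fintype.card F : ℕ) : ZMod r) = r - 1) (hζ : IsPrimitiveRoot ζ r)
    (hr2 : 2 < r) {a : F} (ha : a ≠ 0) (ha2 : a ^ 2 ≠ 1) (e : ℤ) {n : ℕ} (hn : 2 * n < r - 1)
    (hchar : ∀ m, 0 < m → m ≤ n → (m : F) ≠ 0) :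
    Fintype.card (Nat.Partition n) ^ 2 ≤ orderOf (ζ ^ e * (ζ + algebraMap F K a)) := by
  have hζ0 : ζ ≠ 0 := hζ.ne_zero hr.ne_zero
  have hle : ∀ (l : Nat.Partition n) {m : ℕ}, m ∈ l.parts → m ≤ n := fun l m hm =>
    (Multiset.single_le_sum (fun _ _ => Nat.zero_le _) _ hm).trans l.parts_sum.le
  rw [sq, ← Fintype.card_prod]
  refine card_le_orderOf (mul_ne_zero (zpow_ne_zero _ hζ0) (add_algebraMap_ne_zero hr hq hζ hr2 a))
    (fun l : Nat.Partition n × Nat.Partition n =>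
      (l.1.parts.map fun m => (ζ ^ m) ^ e * (ζ ^ m + algebraMap F K a)).prod *
      (l.2.parts.map fun m => ((ζ ^ m)⁻¹) ^ e * ((ζ ^ m)⁻¹ + algebraMap F K a)).prod) ?_ ?_
  · rintro ⟨l₁, l₂⟩ ⟨l₁', l₂'⟩ h
    simp only [prod_pow_zpow_mul_add, prod_inv_pow_zpow_mul_add hζ0, Nat.Partition.parts_sum] at h
    rw [mul_mul_mul_comm, mul_mul_mul_comm _ _ (_ ^ (e + 1))] at h
    have h' := mul_left_cancel₀ (mul_ne_zero (zpow_ne_zero _ (pow_ne_zero _ hζ0))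
      (zpow_ne_zero _ (inv_ne_zero (pow_ne_zero _ hζ0)))) h
    rw [← map_mul, ← map_mul, ← Multiset.prod_add, ← Multiset.prod_add, ← Multiset.map_add,
      ← Multiset.map_add] at h'
    have hmem : ∀ l l' : Nat.Partition n, ∀ i ∈ l.parts.label false + l'.parts.label true,
        (i.1 : F) ≠ 0 ∧ (i.2 = true → a ^ 2 ≠ 1) := by
      intro l l' i hi
      refine ⟨?_, fun _ => ha2⟩
      rcases Multiset.mem_add.1 hi with hi | hi <;>
        obtain ⟨m, hm, rfl⟩ := Multiset.mem_map.1 hi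
      · exact hchar m (l.parts_pos hm) (hle l hm)
      · exact hchar m (l'.parts_pos hm) (hle l' hm)
    have hdeg : ∀ l l' : Nat.Partition n,
        ((l.parts.label false + l'.parts.label true).map Prod.fst).sum < r - 1 := by
      intro l l'
      simp [Multiset.label, l.parts_sum, l'.parts_sum]
      omega
    obtain ⟨h₁, h₂⟩ := Multiset.label_add_label_inj (eq_of_aeval_prod_binomialFactor_eq hr hq hζ ha
      _ _ (hmem l₁ l₂) (hmem l₁' l₂') (hdeg l₁ l₂) (hdeg l₁' l₂') h')
    exact Prod.ext (Nat.Partition.ext h₁) (Nat.Partition.ext h₂)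
  · intro l
    refine mul_mem (Submonoid.multiset_prod_mem _ _ fun x hx => ?_)
      (Submonoid.multiset_prod_mem _ _ fun x hx => ?_)
    · obtain ⟨m, hm, rfl⟩ := Multiset.mem_map.1 hx
      have hmn := hle _ hm
      obtain ⟨i, hi⟩ := exists_frobenius_pow_eq_pow (F := F) hr hq hζ
        (Nat.coprime_of_lt_prime (l.1.parts_pos hm).ne' (by omega) hr).symm
      have := frobeniusAlgHom_pow_mem_powers (F := F) (ζ ^ e * (ζ + algebraMap F K a)) i
      rwa [map_mul, map_zpow₀, map_add, hi, AlgHom.commutes] at this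
    · obtain ⟨m, hm, rfl⟩ := Multiset.mem_map.1 hx
      have hmn := hle _ hm
      obtain ⟨i, hi⟩ := exists_frobenius_pow_eq_inv (F := F) hr hq hζ (l.2.parts_pos hm)
        (by omega)
      have := frobeniusAlgHom_pow_mem_powers (F := F) (ζ ^ e * (ζ + algebraMap F K a)) i
      rwa [map_mul, map_zpow₀, map_add, hi, AlgHom.commutes] at this

/-- If `a ^ 2 ≠ 1`, the order of `(a ζ + 1) / (ζ + a)` is at least the number of partitions
of `n`. -/
theorem card_partition_le_orderOf_div (hr : r.Prime)
    (hq : orderOf ((Fintype.card F : ℕ) : ZMod r) = r - 1) (hζ : IsPrimitiveRoot ζ r)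
    (hr2 : 2 < r) {a : F} (ha : a ≠ 0) (ha2 : a ^ 2 ≠ 1) {n : ℕ} (hn : 2 * n < r - 1)
    (hchar : ∀ m, 0 < m → m ≤ n → (m : F) ≠ 0) :
    Fintype.card (Nat.Partition n) ≤
      orderOf ((algebraMap F K a * ζ + 1) * (ζ + algebraMap F K a)⁻¹) := by
  have hle : ∀ (l : Nat.Partition n) {m : ℕ}, m ∈ l.parts → m ≤ n := fun l m hm =>
    (Multiset.single_le_sum (fun _ _ => Nat.zero_le _) _ hm).trans l.parts_sum.le
  have hnum : algebraMap F K a * ζ + 1 ≠ 0 := by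
    have := aeval_prod_binomialFactor_ne_zero hr hq hζ a {(1, true)} (by simp) (by simp; omega)
    simpa [binomialFactor] using this
  refine card_le_orderOf (mul_ne_zero hnum (inv_ne_zero (add_algebraMap_ne_zero hr hq hζ hr2 a)))
    (fun l : Nat.Partition n => (l.parts.map fun m =>
      (algebraMap F K a * ζ ^ m + 1) * (ζ ^ m + algebraMap F K a)⁻¹).prod) ?_ ?_
  · intro l l' h
    have hden : ∀ l : Nat.Partition n,
        aeval ζ ((l.parts.label false).map (binomialFactor a)).prod ≠ 0 := by
      intro l
      refine aeval_prod_binomialFactor_ne_zero hr hq hζ a _ (fun i hi => ?_) ?_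
      · obtain ⟨m, hm, rfl⟩ := Multiset.mem_map.1 hi
        exact l.parts_pos hm
      · simp [Multiset.label, l.parts_sum]
        omega
    -- Clearing denominators pairs the numerator of each partition with the denominator of the
    -- other, which is why total degree 2n must stay below r - 1.
    simp only [prod_mul_inv] at h
    rw [← div_eq_mul_inv, ← div_eq_mul_inv, div_eq_div_iff (hden l) (hden l'), ← map_mul,
      ← map_mul, ← Multiset.prod_add, ← Multiset.prod_add, ← Multiset.map_add,
      ← Multiset.map_add, add_comm, add_comm (l'.parts.label true)] at h
    have hmem : ∀ l l' : Nat.Partition n, ∀ i ∈ l.parts.label false + l'.parts.label true,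
        (i.1 : F) ≠ 0 ∧ (i.2 = true → a ^ 2 ≠ 1) := by
      intro l l' i hi
      refine ⟨?_, fun _ => ha2⟩
      rcases Multiset.mem_add.1 hi with hi | hi <;>
        obtain ⟨m, hm, rfl⟩ := Multiset.mem_map.1 hi
      · exact hchar m (l.parts_pos hm) (hle l hm)
      · exact hchar m (l'.parts_pos hm) (hle l' hm)
    have hdeg : ∀ l l' : Nat.Partition n,
        ((l.parts.label false + l'.parts.label true).map Prod.fst).sum < r - 1 := by
      intro l l'
      simp [Multiset.label, l.parts_sum, l'.parts_sum]
      omega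
    exact Nat.Partition.ext (Multiset.label_add_label_inj (eq_of_aeval_prod_binomialFactor_eq hr hq
      hζ ha _ _ (hmem l' l) (hmem l l') (hdeg l' l) (hdeg l l') h)).2
  · intro l
    refine Submonoid.multiset_prod_mem _ _ fun x hx => ?_
    obtain ⟨m, hm, rfl⟩ := Multiset.mem_map.1 hx
    have hmn := hle l hm
    obtain ⟨i, hi⟩ := exists_frobenius_pow_eq_pow (F := F) hr hq hζ
      (Nat.coprime_of_lt_prime (l.parts_pos hm).ne' (by omega) hr).symm
    have := frobeniusAlgHom_pow_mem_powers (F := F)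
      ((algebraMap F K a * ζ + 1) * (ζ + algebraMap F K a)⁻¹) i
    rwa [map_mul, map_inv₀, map_add, map_add, map_mul, hi, AlgHom.commutes, map_one] at this

end Frobenius

/-! ### Combining elements of nearly coprime order. -/

theorem rhoTwo_eq_two_iff (n : ℕ) : rhoTwo n = 2 ↔ n % 4 = 2 := by
  rcases Nat.eq_zero_or_pos n with rfl | hn
  · simp [rhoTwo]
  · have h1 : rhoTwo n = 2 ↔ padicValNat 2 n = 1 := by
      rw [rhoTwo]
      conv_lhs => rw [← pow_one 2, ← pow_mul, one_mul]
      exact Nat.pow_right_inj (by norm_num)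
    have h2 := padicValNat_dvd_iff_le (p := 2) (n := 1) hn.ne'
    have h3 := padicValNat_dvd_iff_le (p := 2) (n := 2) hn.ne'
    rw [h1]
    omega

theorem orderOf_le_two_mul_orderOf_sq {G : Type*} [Group G] [Finite G] (x : G) :
    orderOf x ≤ 2 * orderOf (x ^ 2) := by
  refine Nat.le_of_dvd (Nat.mul_pos two_pos (orderOf_pos _)) (orderOf_dvd_of_pow_eq_one ?_)
  rw [pow_mul, pow_orderOf_eq_one]

theorem orderOf_mul_orderOf_le {G : Type*} [CommGroup G] [Finite G] {x y : G} {m n : ℕ}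
    (hx : x ^ (2 * m) = 1) (hy : y ^ n = 1) (h : m.Coprime n) :
    orderOf x * orderOf y ≤ 2 * orderOf (x ^ 2 * y) := by
  have hx2 : orderOf (x ^ 2) ∣ m := orderOf_dvd_of_pow_eq_one (by rw [← pow_mul, hx])
  have hco : (orderOf (x ^ 2)).Coprime (orderOf y) :=
    Nat.Coprime.of_dvd hx2 (orderOf_dvd_of_pow_eq_one hy) h
  rw [(Commute.all _ _).orderOf_mul_eq_mul_orderOf_of_coprime hco, ← mul_assoc]
  exact Nat.mul_le_mul_right _ (orderOf_le_two_mul_orderOf_sq x)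

theorem orderOf_mul_orderOf_le_of_field {K : Type*} [Field K] [Finite K] {x y : K} {m n : ℕ}
    (hx0 : x ≠ 0) (hy0 : y ≠ 0) (hx : x ^ (2 * m) = 1) (hy : y ^ n = 1) (h : m.Coprime n) :
    orderOf x * orderOf y ≤ 2 * orderOf (x ^ 2 * y) := by
  have := orderOf_mul_orderOf_le (x := Units.mk0 x hx0) (y := Units.mk0 y hy0) (m := m) (n := n)
    (by ext; simpa using hx) (by ext; simpa using hy) h
  simpa [← orderOf_units] using this

section Main

variable {F K : Type*} [Field F] [Fintype F] [Field K] [Algebra F K] {r s : ℕ} {θ : K}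

/-- As f is invertible modulo r, θ^e is a power of θ^f. This reduces arbitrary f to f = 1. -/
theorem exists_primitiveRoot_zpow_mul_eq (hθ : IsPrimitiveRoot θ r) (hr : r ≠ 0) {f : ℤ}
    (hf : IsCoprime f (r : ℤ)) (e : ℤ) (y : K) :
    ∃ e' : ℤ, IsPrimitiveRoot (θ ^ f) r ∧ θ ^ e * (θ ^ f + y) = (θ ^ f) ^ e' * (θ ^ f + y) := by
  obtain ⟨u, v, huv⟩ := id hf
  refine ⟨u * e, hθ.zpow_of_gcd_eq_one f (Int.isCoprime_iff_gcd_eq_one.1 hf), ?_⟩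
  have h1 : θ ^ (r : ℤ) = 1 := by rw [zpow_natCast, hθ.pow_eq_one]
  have hθ0 : θ ≠ 0 := hθ.ne_zero hr
  congr 1
  rw [← zpow_mul]
  have : e = f * (u * e) + r * (v * e) := by linear_combination (-e) * huv
  conv_lhs => rw [this, zpow_add₀ hθ0, zpow_mul θ (r : ℤ), h1, one_zpow, mul_one]

/-- Modulo r, q^s squares to 1 without being 1, so it is -1. -/
theorem pow_card_pow_eq_inv (hr : r.Prime) (hrs : r = 2 * s + 1) (hs : 0 < s)
    (hq : orderOf ((Fintype.card F : ℕ) : ZMod r) = r - 1) (hθ : IsPrimitiveRoot θ r) :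
    (FiniteField.frobeniusAlgHom F K ^ s) θ = θ⁻¹ := by
  have : Fact r.Prime := ⟨hr⟩
  rw [frobeniusAlgHom_pow_apply]
  set q := Fintype.card F
  have h1 : ((q : ZMod r) ^ s) ^ 2 = 1 := by
    rw [← pow_mul, mul_comm, show 2 * s = orderOf (q : ZMod r) by omega, pow_orderOf_eq_one]
  have h2 : (q : ZMod r) ^ s ≠ 1 := by
    intro h
    have := Nat.le_of_dvd hs (orderOf_dvd_of_pow_eq_one h)
    omega
  have h3 : ((q ^ s + 1 : ℕ) : ZMod r) = 0 := by
    push_cast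
    rcases (sq_eq_one_iff.1 h1) with h | h
    · exact absurd h h2
    · rw [h]; simp
  rw [ZMod.natCast_eq_zero_iff] at h3
  obtain ⟨c, hc⟩ := h3
  refine eq_inv_of_mul_eq_one_left ?_
  rw [← pow_succ, hc, pow_mul, hθ.pow_eq_one, one_pow]

/-- The trace-like element `θ + θ⁻¹` and the ratio `(a θ + 1) / (θ + a)` combine to an element
whose order is at least half the product of their orders. -/
theorem card_partition_mul_le_orderOf [Finite K] (hr : r.Prime) (hrs : r = 2 * s + 1) (hs : 1 < s)
    (hq : orderOf ((Fintype.card F : ℕ) : ZMod r) = r - 1) (hθ : IsPrimitiveRoot θ r)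
    {a : F} (ha : a ≠ 0) (ha2 : a ^ 2 ≠ 1)
    (hchar : ∀ m, 0 < m → m ≤ r - 2 → (m : F) ≠ 0) (z : K)
    (hz : (Fintype.card F ^ s % 4 = 3 ∧ z = (θ + θ⁻¹) ^ 2 *
        ((algebraMap F K a * θ + 1) * (θ + algebraMap F K a)⁻¹)) ∨
      (Fintype.card F ^ s % 4 = 1 ∧ z = (θ + θ⁻¹) *
        ((algebraMap F K a * θ + 1) * (θ + algebraMap F K a)⁻¹) ^ 2)) :
    Fintype.card (Nat.Partition (r - 2)) * Fintype.card (Nat.Partition (s - 1)) ≤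
      2 * orderOf z := by
  have hθ0 : θ ≠ 0 := hθ.ne_zero hr.ne_zero
  have hinv := pow_card_pow_eq_inv hr hrs (by omega) hq hθ
  -- Writing θ + θ⁻¹ = θ⁻¹(θ² + 1) makes it an instance of the one-partition bound, with constant 1
  -- and f = 2.
  obtain ⟨e', hprim, he'⟩ := exists_primitiveRoot_zpow_mul_eq hθ hr.ne_zero (f := 2)
    (by rw [Int.isCoprime_iff_gcd_eq_one]
        exact Nat.coprime_of_lt_prime (by norm_num) (by omega) hr |>.symm) (-1) (algebraMap F K 1)
  have hxeq : θ + θ⁻¹ = (θ ^ (2 : ℤ)) ^ e' * (θ ^ (2 : ℤ) + algebraMap F K 1) := by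
    rw [← he', map_one, zpow_neg_one, zpow_ofNat]
    field_simp
  have hx := card_partition_le_orderOf (F := F) hr hq hprim (by omega) one_ne_zero e'
    (n := r - 2) (by omega) hchar
  have hx0 : θ + θ⁻¹ ≠ 0 := by
    rw [hxeq]
    exact mul_ne_zero (zpow_ne_zero _ (zpow_ne_zero _ hθ0))
      (add_algebraMap_ne_zero hr hq hprim (by omega) 1)
  rw [← hxeq] at hx
  have hy := card_partition_le_orderOf_div hr hq hθ (by omega) ha ha2 (n := s - 1) (by omega)
    (fun m hm hms => hchar m hm (by omega))
  have hden := add_algebraMap_ne_zero hr hq hθ (by omega) a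
  have hnum : algebraMap F K a * θ + 1 ≠ 0 := by
    have := aeval_prod_binomialFactor_ne_zero hr hq hθ a {(1, true)} (by simp) (by simp; omega)
    simpa [binomialFactor] using this
  set x := θ + θ⁻¹ with hxdef
  set y := (algebraMap F K a * θ + 1) * (θ + algebraMap F K a)⁻¹ with hydef
  have hy0 : y ≠ 0 := mul_ne_zero hnum (inv_ne_zero hden)
  have hxfix : x ^ Fintype.card F ^ s = x := by
    rw [← frobeniusAlgHom_pow_apply, hxdef, map_add, map_inv₀, hinv, inv_inv, add_comm]
  have hyinv : y ^ Fintype.card F ^ s = y⁻¹ := by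
    rw [← frobeniusAlgHom_pow_apply, hydef, map_mul, map_inv₀, map_add, map_add, map_mul, hinv,
      AlgHom.commutes, map_one, mul_inv, inv_inv]
    have h1 : algebraMap F K a * θ⁻¹ + 1 = (θ + algebraMap F K a) * θ⁻¹ := by
      field_simp
      ring
    have h2 : θ⁻¹ + algebraMap F K a = (algebraMap F K a * θ + 1) * θ⁻¹ := by
      field_simp
      ring
    rw [h1, h2]
    field_simp
  set Q := Fintype.card F ^ s
  have hQ : 0 < Q := pow_pos Fintype.card_pos _
  have hx1 : x ^ (Q - 1) = 1 := by
    refine mul_right_cancel₀ hx0 ?_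
    rw [← pow_succ, Nat.sub_add_cancel hQ, hxfix, one_mul]
  have hy1 : y ^ (Q + 1) = 1 := by rw [pow_succ, hyinv, inv_mul_cancel₀ hy0]
  refine (Nat.mul_le_mul hx hy).trans ?_
  -- Q - 1 and Q + 1 have greatest common divisor 2. The one that is 2 modulo 4 has an odd half,
  -- coprime to the other, and the element belonging to it is squared.
  rcases hz with ⟨hmod, rfl⟩ | ⟨hmod, rfl⟩
  · refine orderOf_mul_orderOf_le_of_field hx0 hy0 (m := (Q - 1) / 2) (n := Q + 1) ?_ hy1 ?_
    · rw [show 2 * ((Q - 1) / 2) = Q - 1 by omega, hx1]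
    · have hodd : ((Q - 1) / 2).Coprime 2 := by
        rw [Nat.coprime_two_right, Nat.odd_iff]
        omega
      have h1 : Q + 1 = 2 * ((Q - 1) / 2) + 2 := by omega
      refine Nat.coprime_of_dvd' fun k hk h2 h3 => ?_
      have h4 : k ∣ 2 := (Nat.dvd_add_right (Dvd.dvd.mul_left h2 2)).1 (h1 ▸ h3)
      exact (Nat.Coprime.eq_one_of_dvd (Nat.Coprime.coprime_dvd_left h2 hodd) h4) ▸ dvd_rfl
  · rw [mul_comm (orderOf x), mul_comm x]
    refine orderOf_mul_orderOf_le_of_field hy0 hx0 (m := (Q + 1) / 2) (n := Q - 1) ?_ hx1 ?_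
    · rw [show 2 * ((Q + 1) / 2) = Q + 1 by omega, hy1]
    · have hodd : ((Q + 1) / 2).Coprime 2 := by
        rw [Nat.coprime_two_right, Nat.odd_iff]
        omega
      have h1 : Q - 1 + 2 = 2 * ((Q + 1) / 2) := by omega
      refine Nat.coprime_of_dvd' fun k hk h2 h3 => ?_
      have h4 : k ∣ 2 := (Nat.dvd_add_right h3).1 (h1 ▸ Dvd.dvd.mul_left h2 2)
      exact (Nat.Coprime.eq_one_of_dvd (Nat.Coprime.coprime_dvd_left h2 hodd) h4) ▸ dvd_rfl

end Main

end Orders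

/-! ### Explicit bounds and the final assembly. -/

open Real in
theorem two_mul_exp_div_lt_sq {n : ℕ} (hn : 0 < n) {r : ℝ} (hr : r - 3 = 2 * n) :
    2 * exp (2.5 * √2 * √(r - 3)) / (169 * (r - 3) ^ 2) <
      (Fintype.card (Nat.Partition n) : ℝ) ^ 2 := by
  have hn0 : (0 : ℝ) < n := by exact_mod_cast hn
  have h := exp_div_lt_card_partition hn
  have h2 : exp (2.5 * √2 * √(r - 3)) = exp (2.5 * √n) ^ 2 := by
    rw [hr, Real.sqrt_mul zero_le_two, ← exp_nat_mul]
    congr 1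
    have : √(2 : ℝ) * √2 = 2 := Real.mul_self_sqrt zero_le_two
    push_cast
    linear_combination 2.5 * √(n : ℝ) * this
  have hsq : (exp (2.5 * √n) / (13 * n)) ^ 2 < (Fintype.card (Nat.Partition n) : ℝ) ^ 2 :=
    pow_lt_pow_left₀ h (by positivity) two_ne_zero
  -- Since r - 3 = 2n, the claimed bound is exactly half of what Maróti's bound gives.
  refine lt_of_le_of_lt ?_ hsq
  rw [h2, hr, div_pow, div_le_div_iff₀ (by positivity) (by positivity)]
  have : 0 ≤ exp (2.5 * √n) ^ 2 * (n : ℝ) ^ 2 := by positivity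
  nlinarith

open Real in
theorem exp_div_lt_mul_div_two {m n : ℕ} (hn : 0 < n) {r : ℝ} (hr : r - 3 = 2 * n)
    (hm : r - 2 = m) :
    exp (2.5 * (1 + √2 / 2) * √(r - 3)) / (169 * (r - 2) * (r - 3)) <
      (Fintype.card (Nat.Partition m) : ℝ) * Fintype.card (Nat.Partition n) / 2 := by
  have hn0 : (0 : ℝ) < n := by exact_mod_cast hn
  have hm0 : (0 : ℝ) < m := by linarith
  have h1 := exp_div_lt_card_partition hn
  have h2 := exp_div_lt_card_partition (n := m) (by exact_mod_cast hm0)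
  have hle : exp (2.5 * (1 + √2 / 2) * √(r - 3)) ≤ exp (2.5 * √m) * exp (2.5 * √n) := by
    rw [← exp_add, exp_le_exp]
    have e1 : √2 / 2 * √(r - 3) = √(n : ℝ) := by
      have : √(2 : ℝ) * √2 = 2 := Real.mul_self_sqrt zero_le_two
      rw [hr, Real.sqrt_mul zero_le_two]
      linear_combination √(n : ℝ) / 2 * this
    have e2 : √(r - 3) ≤ √(m : ℝ) := Real.sqrt_le_sqrt (by linarith)
    calc 2.5 * (1 + √2 / 2) * √(r - 3) = 2.5 * √(r - 3) + 2.5 * (√2 / 2 * √(r - 3)) := by ring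
      _ ≤ _ := by rw [e1]; linarith
  have h3 : exp (2.5 * √m) / (13 * m) * (exp (2.5 * √n) / (13 * n)) <
      (Fintype.card (Nat.Partition m) : ℝ) * Fintype.card (Nat.Partition n) :=
    mul_lt_mul'' h2 h1 (by positivity) (by positivity)
  -- The factor 2 lost by squaring is absorbed exactly, as 13m · 13n · 2 = 169(r - 2)(r - 3).
  refine lt_of_le_of_lt ?_ (div_lt_div_of_pos_right h3 zero_lt_two)
  rw [hr, hm] at *
  calc _ ≤ exp (2.5 * √m) * exp (2.5 * √n) / (169 * m * (2 * n)) := by gcongr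
    _ = _ := by field_simp; norm_num

theorem corollary5
    (p k q r s : ℕ) (hp : p.Prime) (hk : 0 < k) (hq : q = p ^ k)
    (hr : r.Prime) (hrs : r = 2 * s + 1) (hqr : Nat.Coprime q r)
    -- `q` is a primitive root modulo `r`
    (hprim : orderOf (q : ZMod r) = r - 1)
    -- `F` is the field with `q` elements
    {F : Type*} [Field F] (hF : Nat.card F = q)
    -- `K = F(θ) = F[x] / Φ_r(x)`, where `θ` is the class of `x`
    {K : Type*} [Field K] [Algebra F K] (θ : K)
    (hθ : Polynomial.aeval θ (Polynomial.cyclotomic r F) = 0)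
    (hgen : IntermediateField.adjoin F {θ} = ⊤)
    (hrp : (r : ℤ) - 2 < p)
    (e f : ℤ) (hf : IsCoprime f (r : ℤ)) (a : F) (ha : a ≠ 0) :
    (Real.exp (2.5 * √((r : ℝ) - 2)) / (13 * ((r : ℝ) - 2))
        < (orderOf (θ ^ e * (θ ^ f + algebraMap F K a)) : ℝ)) ∧
    (3 < r → a ≠ 1 → a ≠ -1 →
      2 * Real.exp (2.5 * √2 * √((r : ℝ) - 3)) / (169 * ((r : ℝ) - 3) ^ 2)
        < (orderOf (θ ^ e * (θ ^ f + algebraMap F K a)) : ℝ)) ∧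
    (3 < r → a ≠ 1 → a ≠ -1 →
      -- exactly one of the two cases in the definition of `z` applies
      Xor (rhoTwo (q ^ ((r - 1) / 2) - 1) = 2) (rhoTwo (q ^ ((r - 1) / 2) + 1) = 2) ∧
      ∀ z : K,
        (rhoTwo (q ^ ((r - 1) / 2) - 1) = 2 →
          z = (θ + θ⁻¹) ^ 2 *
            ((algebraMap F K a * θ + 1) * (θ + algebraMap F K a)⁻¹)) →
        (rhoTwo (q ^ ((r - 1) / 2) + 1) = 2 →
          z = (θ + θ⁻¹) *
            ((algebraMap F K a * θ + 1) * (θ + algebraMap F K a)⁻¹) ^ 2) →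
        Real.exp (2.5 * (1 + √2 / 2) * √((r : ℝ) - 3)) /
            (169 * ((r : ℝ) - 2) * ((r : ℝ) - 3))
          < (orderOf z : ℝ)) := by
  have hr2 : 2 < r := by
    have := hr.two_le
    omega
  have hq0 : q ≠ 0 := by
    rw [hq]
    exact pow_ne_zero _ hp.ne_zero
  have : Finite F := Nat.finite_of_card_ne_zero (by rw [hF]; exact hq0)
  have : Fintype F := Fintype.ofFinite F
  have : Fact p.Prime := ⟨hp⟩
  have hcard : Fintype.card F = q := by rw [← Nat.card_eq_fintype_card, hF]
  have : CharP F p := charP_of_card_eq_prime_pow (hcard.trans hq)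
  have : CharP K p := charP_of_injective_algebraMap (algebraMap F K).injective p
  have hpr : p ≠ r := by
    rintro rfl
    rw [hq, Nat.coprime_pow_left_iff hk, Nat.coprime_self] at hqr
    exact hp.one_lt.ne' hqr
  have hrK : NeZero (r : K) := ⟨fun h => hpr
    ((Nat.prime_dvd_prime_iff_eq hp hr).1 ((CharP.cast_eq_zero_iff K p r).1 h))⟩
  have hprimθ : IsPrimitiveRoot θ r := by
    rw [← Polynomial.isRoot_cyclotomic_iff, Polynomial.IsRoot.def,
      ← Polynomial.map_cyclotomic r (algebraMap F K),
      Polynomial.eval_map_algebraMap, hθ]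
  have : Finite K := by
    have hint : IsIntegral F θ :=
      IsAlgebraic.isIntegral ⟨_, Polynomial.cyclotomic_ne_zero r F, hθ⟩
    have := IntermediateField.adjoin.finiteDimensional hint
    rw [hgen] at this
    have : FiniteDimensional F K :=
      Module.Finite.equiv (IntermediateField.topEquiv (F := F) (E := K)).toLinearEquiv
    exact Module.finite_of_finite F
  have hord : orderOf ((Fintype.card F : ℕ) : ZMod r) = r - 1 := by rw [hcard, hprim]
  have hchar : ∀ m, 0 < m → m ≤ r - 2 → (m : F) ≠ 0 := by
    intro m hm hmr h0
    have := Nat.le_of_dvd hm ((CharP.cast_eq_zero_iff F p m).1 h0)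
    omega
  have hr2R : (r : ℝ) - 2 = ((r - 2 : ℕ) : ℝ) := by
    rw [Nat.cast_sub hr2.le]
    norm_num
  obtain ⟨e', hζ, he'⟩ := exists_primitiveRoot_zpow_mul_eq hprimθ hr.ne_zero hf e
    (algebraMap F K a)
  refine ⟨?_, fun h3 ha1 ha1' => ?_, fun h3 ha1 ha1' => ?_⟩
  · have h := card_partition_le_orderOf hr hord hζ hr2 ha e' (n := r - 2) (by omega) hchar
    rw [he', hr2R]
    exact (exp_div_lt_card_partition (by omega)).trans_le (by exact_mod_cast h)
  · have ha2 : a ^ 2 ≠ 1 := fun h => (sq_eq_one_iff.1 h).elim ha1 ha1'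
    have h := card_partition_sq_le_orderOf hr hord hζ hr2 ha ha2 e' (n := s - 1) (by omega)
      (fun m hm hms => hchar m hm (by omega))
    rw [he']
    refine (two_mul_exp_div_lt_sq (n := s - 1) (by omega) ?_).trans_le (by exact_mod_cast h)
    rw [Nat.cast_sub (by omega), hrs]
    push_cast
    ring
  · have ha2 : a ^ 2 ≠ 1 := fun h => (sq_eq_one_iff.1 h).elim ha1 ha1'
    have hs : (r - 1) / 2 = s := by omega
    -- Here r ≥ 5, hence p > 3 and p is odd.
    have hodd : q ^ s % 2 = 1 := by
      rw [← Nat.odd_iff, hq]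
      exact ((hp.odd_of_ne_two (by omega)).pow).pow
    rw [hs, rhoTwo_eq_two_iff, rhoTwo_eq_two_iff]
    refine ⟨?_, fun z hz1 hz2 => ?_⟩
    · rcases (by omega : q ^ s % 4 = 1 ∨ q ^ s % 4 = 3) with h | h
      · exact Or.inr ⟨by omega, by omega⟩
      · exact Or.inl ⟨by omega, by omega⟩
    · have h := card_partition_mul_le_orderOf hr hrs (by omega) hord hprimθ ha ha2 hchar z (by
        rw [hcard]
        rcases (by omega : q ^ s % 4 = 1 ∨ q ^ s % 4 = 3) with h | h
        · exact Or.inr ⟨h, hz2 (by omega)⟩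
        · exact Or.inl ⟨h, hz1 (by omega)⟩)
      refine (exp_div_lt_mul_div_two (n := s - 1) (by omega) ?_ hr2R).trans_le ?_
      · rw [Nat.cast_sub (by omega), hrs]
        push_cast
        ring
      · rw [div_le_iff₀ two_pos, mul_comm (orderOf z : ℝ)]
        exact_mod_cast h
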